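/- There are an algorithm and an absolute constant $C$ with the following property. Let $n \ge 1$, let $B_1,\dots,B_n \ge 1$ and $B \ge 0$ be integers, let $0 < \varepsilon < 1 - 1/e$, and let $f : \mathbb{Z}_{\ge 0}^n \to \mathbb{R}_{\ge 0}$ be monotone ($f(x) \le f(y)$ for $x \le y$) and DR-submodular, that is, $$f(x+\chi_i) - f(x) \ \ge\ f(y+\chi_i) - f(y) \qquad \text{for all } x \le y \text{ and all } i \in \{1,\dots,n\},$$ where $\le$ is the coordinatewise order and $\chi_i$ is the $i$-th unit vector. Given $n, B_1,\dots,B_n, B, \varepsilon$ and a value oracle for $f$, the algorithm outputs an integer vector $x$ with $0 \le x_i \le B_i$ for all $i$ and $\|x\|_1 = \sum_i x_i \le B$ such that $$f(x) \ \ge\ \Bigl(1 - \frac1e - \varepsilon\Bigr) \max\bigl\{ f(z) : z \in \mathbb{Z}_{\ge 0}^n,\ z_i \le B_i \text{ for all } i,\ \|z\|_1 \le B \bigr\},$$ and its running time is at most $C \cdot \dfrac{m \log(m/\varepsilon)}{\varepsilon}$, where $m = \dfrac{n}{\varepsilon} + \sum_{i=1}^n \log B_i$. Here an algorithm is a single deterministic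 random access program, the same for all inputs, working on variables and indexed arrays of non-negative integers (with addition, truncated subtraction, comparison and conversion to reals) and of real numbers (with the four arithmetic operations and comparison). Each such operation, each memory access, and each call of the oracle (which returns $f(x)$ for a vector $x$ stored in an array) counts as one step. -/

import Mathlib

/-- The diminishing return property of a function on the integer lattice:
`f (x + χ_i) - f x ≥ f (y + χ_i) - f y` whenever `x ≤ y`. -/
def DRSubmodular {n : ℕ} (f : (Fin n → ℕ) → ℝ) : Prop :=
  ∀ x y : Fin n → ℕ, x ≤ y → ∀ i : Fin n,
    f (y + Pi.single i 1) - f y ≤ f (x + Pi.single i 1) - f x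

/-- The vectors of the box `∏ i, {0, …, b i}` that satisfy `‖x‖₁ ≤ B`. -/
def budgetFeasible {n : ℕ} (b : Fin n → ℕ) (B : ℕ) : Set (Fin n → ℕ) :=
  {x | x ≤ b ∧ ∑ i, x i ≤ B}

/-- The size parameter `m = n / ε + ∑ i, log (b i)`. -/
noncomputable def sizeParam {n : ℕ} (b : Fin n → ℕ) (ε : ℝ) : ℝ :=
  (n : ℝ) / ε + ∑ i, Real.log (b i)

/-! ### Random access machines with a value oracle

Programs are finite texts in a small imperative language. The memory consists of integer and real
variables and of one-dimensional integer and real arrays, all of them indexed by natural numbers;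
a program mentions only finitely many of them. Array cells are addressed by computed integers.
Integers have addition, truncated subtraction and comparison; reals have the four arithmetic
operations and comparison; integers can be converted to reals, but not conversely. The oracle
instruction returns the value of a function at the vector stored in an array. Every operation,
memory access, test, assignment and oracle call is one step. -/

namespace OracleRam

/-- The contents of the memory. -/
structure Store where
  natVar : ℕ → ℕ
  realVar : ℕ → ℝ
  natArr : ℕ → ℕ → ℕ
  realArr : ℕ → ℕ → ℝ

/-- Integer expressions. -/
inductive NatExpr where
  | lit (c : ℕ)
  | var (v : ℕ)
  | get (a : ℕ) (i : NatExpr)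
  | add (p q : NatExpr)
  | sub (p q : NatExpr)

/-- Real expressions. -/
inductive RealExpr where
  | ofNat (e : NatExpr)
  | var (v : ℕ)
  | get (a : ℕ) (i : NatExpr)
  | add (p q : RealExpr)
  | sub (p q : RealExpr)
  | mul (p q : RealExpr)
  | div (p q : RealExpr)

/-- Tests. -/
inductive Test where
  | natLe (p q : NatExpr)
  | realLe (p q : RealExpr)
  | neg (c : Test)
  | both (c d : Test)

/-- Programs. -/
inductive Program where
  | skip
  /-- integer variable `v := e` -/
  | setNat (v : ℕ) (e : NatExpr)
  /-- real variable `v := e` -/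
  | setReal (v : ℕ) (e : RealExpr)
  /-- cell `i` of integer array `a := e` -/
  | putNat (a : ℕ) (i e : NatExpr)
  /-- cell `i` of real array `a := e` -/
  | putReal (a : ℕ) (i : NatExpr) (e : RealExpr)
  /-- real variable `v :=` the oracle's value at the vector stored in integer array `a` -/
  | query (v a : ℕ)
  | seq (P Q : Program)
  | branch (c : Test) (P Q : Program)
  /-- repeat `P` as long as `c` holds -/
  | loop (c : Test) (P : Program)

namespace NatExpr

def eval (s : Store) : NatExpr → ℕ
  | lit c => c
  | var v => s.natVar v
  | get a i => s.natArr a (i.eval s)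
  | add p q => p.eval s + q.eval s
  | sub p q => p.eval s - q.eval s

/-- The number of steps that an evaluation takes. -/
def cost : NatExpr → ℕ
  | lit _ => 1
  | var _ => 1
  | get _ i => i.cost + 1
  | add p q => p.cost + q.cost + 1
  | sub p q => p.cost + q.cost + 1

end NatExpr

namespace RealExpr

noncomputable def eval (s : Store) : RealExpr → ℝ
  | ofNat e => (e.eval s : ℝ)
  | var v => s.realVar v
  | get a i => s.realArr a (i.eval s)
  | add p q => p.eval s + q.eval s
  | sub p q => p.eval s - q.eval s
  | mul p q => p.eval s * q.eval s
  | div p q => p.eval s / q.eval s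

/-- The number of steps that an evaluation takes. -/
def cost : RealExpr → ℕ
  | ofNat e => e.cost + 1
  | var _ => 1
  | get _ i => i.cost + 1
  | add p q => p.cost + q.cost + 1
  | sub p q => p.cost + q.cost + 1
  | mul p q => p.cost + q.cost + 1
  | div p q => p.cost + q.cost + 1

end RealExpr

namespace Test

def Holds (s : Store) : Test → Prop
  | natLe p q => p.eval s ≤ q.eval s
  | realLe p q => p.eval s ≤ q.eval s
  | neg c => ¬ c.Holds s
  | both c d => c.Holds s ∧ d.Holds s

/-- The number of steps that an evaluation takes. -/
def cost : Test → ℕ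
  | natLe p q => p.cost + q.cost + 1
  | realLe p q => p.cost + q.cost + 1
  | neg c => c.cost + 1
  | both c d => c.cost + d.cost + 1

end Test

namespace Store

def setNat (s : Store) (v k : ℕ) : Store :=
  { s with natVar := Function.update s.natVar v k }

def setReal (s : Store) (v : ℕ) (r : ℝ) : Store :=
  { s with realVar := Function.update s.realVar v r }

def putNat (s : Store) (a i k : ℕ) : Store :=
  { s with natArr := Function.update s.natArr a (Function.update (s.natArr a) i k) }

def putReal (s : Store) (a i : ℕ) (r : ℝ) : Store :=
  { s with realArr := Function.update s.realArr a (Function.update (s.realArr a) i r) }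

/-- The first `n` cells of integer array `a`, as a vector. -/
def vec (s : Store) (n a : ℕ) : Fin n → ℕ := fun i => s.natArr a i

end Store

/-- `Exec f P s t s'`: with the value oracle `f`, the program `P` started in the memory `s` halts
after exactly `t` steps with the memory `s'`. -/
inductive Exec {n : ℕ} (f : (Fin n → ℕ) → ℝ) : Program → Store → ℕ → Store → Prop where
  | skip (s : Store) : Exec f Program.skip s 1 s
  | setNat (s : Store) (v : ℕ) (e : NatExpr) :
      Exec f (Program.setNat v e) s (e.cost + 1) (s.setNat v (e.eval s))
  | setReal (s : Store) (v : ℕ) (e : RealExpr) :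
      Exec f (Program.setReal v e) s (e.cost + 1) (s.setReal v (e.eval s))
  | putNat (s : Store) (a : ℕ) (i e : NatExpr) :
      Exec f (Program.putNat a i e) s (i.cost + e.cost + 1) (s.putNat a (i.eval s) (e.eval s))
  | putReal (s : Store) (a : ℕ) (i : NatExpr) (e : RealExpr) :
      Exec f (Program.putReal a i e) s (i.cost + e.cost + 1) (s.putReal a (i.eval s) (e.eval s))
  | query (s : Store) (v a : ℕ) :
      Exec f (Program.query v a) s 1 (s.setReal v (f (s.vec n a)))
  | seq {P Q : Program} {s₁ s₂ s₃ : Store} {t₁ t₂ : ℕ} :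
      Exec f P s₁ t₁ s₂ → Exec f Q s₂ t₂ s₃ → Exec f (Program.seq P Q) s₁ (t₁ + t₂) s₃
  | branch_true {c : Test} {P Q : Program} {s s' : Store} {t : ℕ} :
      c.Holds s → Exec f P s t s' → Exec f (Program.branch c P Q) s (c.cost + 1 + t) s'
  | branch_false {c : Test} {P Q : Program} {s s' : Store} {t : ℕ} :
      ¬ c.Holds s → Exec f Q s t s' → Exec f (Program.branch c P Q) s (c.cost + 1 + t) s'
  | loop_stop {c : Test} {P : Program} {s : Store} :
      ¬ c.Holds s → Exec f (Program.loop c P) s (c.cost + 1) s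
  | loop_step {c : Test} {P : Program} {s₁ s₂ s₃ : Store} {t₁ t₂ : ℕ} :
      c.Holds s₁ → Exec f P s₁ t₁ s₂ → Exec f (Program.loop c P) s₂ t₂ s₃ →
      Exec f (Program.loop c P) s₁ (c.cost + 1 + t₁ + t₂) s₃

/-- The initial memory: integer variables `0` and `1` hold `n` and the budget `B`, integer array `0`
holds the bounds `b`, real variable `0` holds `ε`, and everything else is zero. -/
noncomputable def input {n : ℕ} (b : Fin n → ℕ) (B : ℕ) (ε : ℝ) : Store where
  natVar v := if v = 0 then n else if v = 1 then B else 0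
  realVar v := if v = 0 then ε else 0
  natArr a i := if h : a = 0 ∧ i < n then b ⟨i, h.2⟩ else 0
  realArr _ _ := 0

/-- The result of a run on vectors of length `n` is read from integer array `1`. -/
def output (n : ℕ) (s : Store) : Fin n → ℕ := s.vec n 1

end OracleRam

/-! This is threshold greedy, with a head start that makes the number of thresholds independent of
`B`. Put δ = ε/4 and let z be optimal. While all usable marginals are at most θ/(1-δ), diminishing
returns give f z - f x ≤ Bθ/(1-δ) (`sub_le_of_marginal_le`), so a unit gaining at least θ closes a
fraction (1-δ)/B of the gap (`gap_add_single`). If the budget left after N initial units is spent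
entirely, the gap is at most exp(-(1-δ)(B-N)/B) f z; otherwise it is at most Bθ/(1-δ) for the last θ
(`GreedyInv.final`). Hence it suffices to reach Bθ ≤ δ f z.

Descending that far from the largest marginal at 0 would take about log(B/δ)/δ thresholds, and log B
is not O(log(m/ε)). So each coordinate first receives about δB/n units, at most a fraction δ of the
budget. If D is the marginal of a direction i that is still below its bound, then x_i + 1 ≥ δB/n
units in that direction gain at least D each, whence δBD ≤ n f z (`mul_maxMarginal_le`). Going from
D down to Dδ²/n is then enough, which takes O(log(n/δ)/δ) geometric steps (`exists_pow_le`).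

Gains along one coordinate never increase, so the largest worthwhile step is found by binary search
in O(1 + log B_i) operations, and a sweep costs O(m) (`sweep_runs`, `bitSize_le_sizeParam`). The
programs are verified in a Hoare logic with step budgets (`Runs`). -/

/-- The gain of raising coordinate `i` by one. -/
def marginal {n : ℕ} (f : (Fin n → ℕ) → ℝ) (x : Fin n → ℕ) (i : Fin n) : ℝ :=
  f (x + Pi.single i 1) - f x

/-! ### Consequences of diminishing returns. -/

section Marginal

variable {n : ℕ} {f : (Fin n → ℕ) → ℝ}

theorem marginal_anti (hf : DRSubmodular f) {x y : Fin n → ℕ} (h : x ≤ y) (i : Fin n) :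
    marginal f y i ≤ marginal f x i := hf x y h i

theorem marginal_nonneg (hf : Monotone f) (x : Fin n → ℕ) (i : Fin n) : 0 ≤ marginal f x i :=
  sub_nonneg.2 (hf (le_add_of_nonneg_right (by intro j; simp)))

/-- Add the units of `d` one at a time: each gains at most what it would gain at `x`. -/
theorem sub_le_sum_marginal (hf : DRSubmodular f) (x d : Fin n → ℕ) :
    f (x + d) - f x ≤ ∑ j, (d j : ℝ) * marginal f x j := by
  induction hN : ∑ j, d j generalizing d with
  | zero =>
    have hd : d = 0 := by
      funext j
      exact Finset.sum_eq_zero_iff.1 hN j (Finset.mem_univ j)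
    simp [hd]
  | succ N ih =>
    obtain ⟨i, hi⟩ : ∃ i, d i ≠ 0 := by
      by_contra! h
      simp [h] at hN
    obtain ⟨d', rfl⟩ : ∃ d' : Fin n → ℕ, d = d' + Pi.single i 1 := by
      refine ⟨d - Pi.single i 1, ?_⟩
      funext j
      rcases eq_or_ne j i with rfl | hj
      · simp; omega
      · simp [hj]
    have h1 : ∑ j, d' j = N := by
      simp [Finset.sum_add_distrib] at hN
      exact hN
    have h2 := ih d' h1
    have h3 := marginal_anti hf (le_add_of_nonneg_right (fun j => Nat.zero_le _) : x ≤ x + d') i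
    have h4 : ∑ j, (((d' + Pi.single i 1 : Fin n → ℕ) j : ℕ) : ℝ) * marginal f x j
        = ∑ j, (d' j : ℝ) * marginal f x j + marginal f x i := by
      simp [add_mul, Finset.sum_add_distrib, Pi.single_apply]
    rw [h4, ← add_assoc]
    unfold marginal at h3 h2 ⊢
    linarith

/-- Along one direction each of the `k` units gains at least as much as one further unit would. -/
theorem mul_marginal_le (hf : DRSubmodular f) (u : Fin n → ℕ) (i : Fin n) (k : ℕ) :
    k * marginal f (u + Pi.single i k) i ≤ f (u + Pi.single i k) - f u := by
  induction k with
  | zero => simp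
  | succ k ih =>
    have e : u + Pi.single i (k + 1) = u + Pi.single i k + Pi.single i 1 := by
      rw [add_assoc, ← Pi.single_add]
    have h := marginal_anti hf (x := u + Pi.single i k) (y := u + Pi.single i (k + 1))
      (by rw [e]; exact le_add_of_nonneg_right (fun j => Nat.zero_le _)) i
    have h2 : f (u + Pi.single i (k + 1)) - f (u + Pi.single i k)
        = marginal f (u + Pi.single i k) i := by rw [e]; rfl
    have h3 : (k : ℝ) * marginal f (u + Pi.single i (k + 1)) i
        ≤ k * marginal f (u + Pi.single i k) i := by gcongr
    push_cast
    linarith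

/-- Empty coordinate `i`, where `f` is still nonnegative, and refill it. This is why units placed by
the head start force later marginals to be small. -/
theorem succ_mul_marginal_le (hf : DRSubmodular f) (h0 : ∀ x, 0 ≤ f x) (x : Fin n → ℕ)
    (i : Fin n) : ((x i : ℝ) + 1) * marginal f x i ≤ f (x + Pi.single i 1) := by
  have e : Function.update x i 0 + Pi.single i (x i) = x := by
    funext j
    rcases eq_or_ne j i with rfl | hj <;> simp [*]
  have h := mul_marginal_le hf (Function.update x i 0) i (x i)
  rw [e] at h
  have := h0 (Function.update x i 0)
  have h2 : marginal f x i = f (x + Pi.single i 1) - f x := rfl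
  linarith

/-- If all the marginals that `z` can use are at most `θ`, then `z` gains at most `B * θ`. -/
theorem sub_le_of_marginal_le (hf : DRSubmodular f) (hm : Monotone f) {b : Fin n → ℕ} {B : ℕ}
    {x z : Fin n → ℕ} (hz : z ∈ budgetFeasible b B) {θ : ℝ} (hθ : 0 ≤ θ)
    (h : ∀ j, x j < b j → marginal f x j ≤ θ) : f z - f x ≤ B * θ := by
  -- With truncated subtraction, `x + (z - x)` is the join of `x` and `z`.
  have h1 : f z ≤ f (x + (z - x)) := hm (by intro j; simp; omega)
  have h2 := sub_le_sum_marginal hf x (z - x)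
  have h3 : ∑ j, (((z - x) j : ℕ) : ℝ) * marginal f x j ≤ ∑ j, (z j : ℝ) * θ := by
    refine Finset.sum_le_sum fun j _ => ?_
    rcases le_or_gt (z j) (x j) with hj | hj
    · have : (z - x) j = 0 := by simp; omega
      rw [this]
      simp only [Nat.cast_zero, zero_mul]
      positivity
    · have hle : (z - x) j ≤ z j := by simp
      have := h j (hj.trans_le (hz.1 j))
      have := marginal_nonneg hm x j
      gcongr
  have h4 : ∑ j, (z j : ℝ) * θ ≤ B * θ := by
    rw [← Finset.sum_mul]
    have : (∑ j, (z j : ℝ)) ≤ B := by exact_mod_cast hz.2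
    gcongr
  linarith

/-! ### Analysis of threshold greedy. -/

/-- The test of the threshold greedy algorithm: the `t`-th unit added in direction `i` still gains
at least `θ`. -/
def Worth (f : (Fin n → ℕ) → ℝ) (θ : ℝ) (x : Fin n → ℕ) (i : Fin n) (t : ℕ) : Prop :=
  t = 0 ∨ θ ≤ f (x + Pi.single i t) - f (x + Pi.single i (t - 1))

theorem worth_succ_iff {θ : ℝ} {x : Fin n → ℕ} {i : Fin n} {t : ℕ} :
    Worth f θ x i (t + 1) ↔ θ ≤ marginal f (x + Pi.single i t) i := by
  simp [Worth, marginal, add_assoc, ← Pi.single_add]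

/-- This downward closure makes binary search for the largest step exact. -/
theorem Worth.anti (hf : DRSubmodular f) {θ : ℝ} {x : Fin n → ℕ} {i : Fin n} {t u : ℕ}
    (htu : t ≤ u) (h : Worth f θ x i u) : Worth f θ x i t := by
  rcases t with _ | t
  · exact Or.inl rfl
  obtain ⟨u, rfl⟩ : ∃ v, u = v + 1 := ⟨u - 1, by omega⟩
  rw [worth_succ_iff] at h ⊢
  refine h.trans (marginal_anti hf ?_ i)
  gcongr
  omega

/-- The state of the threshold greedy algorithm while the first `i` coordinates have been processed
for the threshold `θ`, started from a vector of norm `N`. -/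
structure GreedyInv (f : (Fin n → ℕ) → ℝ) (b : Fin n → ℕ) (B N : ℕ) (δ : ℝ) (z : Fin n → ℕ)
    (θ : ℝ) (i : ℕ) (x : Fin n → ℕ) : Prop where
  start : N ≤ ∑ j, x j
  gap : f z - f x ≤ Real.exp (-((1 - δ) * ((∑ j, x j : ℕ) - N) / B)) * f z
  all : ∑ j, x j < B → ∀ j, x j < b j → marginal f x j ≤ θ / (1 - δ)
  done : ∑ j, x j < B → ∀ j : Fin n, (j : ℕ) < i → x j < b j → marginal f x j ≤ θ

theorem sum_add_single (x : Fin n → ℕ) (i : Fin n) (k : ℕ) :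
    ∑ j, (x + Pi.single i k : Fin n → ℕ) j = ∑ j, x j + k := by
  simp [Finset.sum_add_distrib]

/-- The analysis adds the `k` units one by one. The bound on marginals survives by diminishing
returns, and `Worth` for `k` passes to every earlier unit, so each multiplies the gap by at most 1 -
c ≤ exp(-c) with c = (1-δ)/B. -/
theorem gap_add_single (hf : DRSubmodular f) (hm : Monotone f) (h0 : ∀ x, 0 ≤ f x)
    {b : Fin n → ℕ} {B N : ℕ} {δ θ : ℝ} (hδ : 0 ≤ δ) (hδ1 : δ < 1) (hθ : 0 ≤ θ)
    {z x : Fin n → ℕ} (hz : z ∈ budgetFeasible b B) {i : Fin n} {k : ℕ}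
    (hB : ∑ j, x j + k ≤ B) (hw : Worth f θ x i k)
    (hgap : f z - f x ≤ Real.exp (-((1 - δ) * ((∑ j, x j : ℕ) - N) / B)) * f z)
    (hall : ∑ j, x j < B → ∀ j, x j < b j → marginal f x j ≤ θ / (1 - δ)) :
    f z - f (x + Pi.single i k)
      ≤ Real.exp (-((1 - δ) * ((∑ j, (x + Pi.single i k : Fin n → ℕ) j : ℕ) - N) / B)) * f z := by
  rw [sum_add_single]
  induction k with
  | zero => simpa using hgap
  | succ k ih =>
    have ih := ih (by omega) (hw.anti hf (Nat.le_succ k))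
    have hBpos : (0 : ℝ) < B := by exact_mod_cast (show 0 < B by omega)
    have hB1 : (1 : ℝ) ≤ B := by exact_mod_cast (show 1 ≤ B by omega)
    have h1 : f z - f (x + Pi.single i k) ≤ B * (θ / (1 - δ)) := by
      have hxk : x ≤ x + Pi.single i k := le_add_of_nonneg_right (fun j => Nat.zero_le _)
      refine sub_le_of_marginal_le hf hm hz (div_nonneg hθ (by linarith)) fun j hj => ?_
      exact (marginal_anti hf hxk j).trans (hall (by omega) j ((hxk j).trans_lt hj))
    rw [worth_succ_iff] at hw
    have e : f (x + Pi.single i (k + 1)) =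
        f (x + Pi.single i k) + marginal f (x + Pi.single i k) i := by
      simp [marginal, add_assoc, ← Pi.single_add]
    set c : ℝ := (1 - δ) / B with hc
    have hc0 : 0 ≤ c := div_nonneg (by linarith) hBpos.le
    have hc1 : c ≤ 1 := by rw [hc, div_le_one hBpos]; linarith
    have h2 : c * (f z - f (x + Pi.single i k)) ≤ θ := by
      calc c * (f z - f (x + Pi.single i k)) ≤ c * (B * (θ / (1 - δ))) := by gcongr
        _ = θ := by
          have : (1 - δ) ≠ 0 := by linarith
          rw [hc]; field_simp
    have h3 : Real.exp (-((1 - δ) * ((∑ j, x j + (k + 1) : ℕ) - N) / B))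
        = Real.exp (-((1 - δ) * ((∑ j, x j + k : ℕ) - N) / B)) * Real.exp (-c) := by
      rw [← Real.exp_add]
      congr 1
      rw [hc]
      push_cast
      field_simp
      ring
    have h4 : 1 - c ≤ Real.exp (-c) := by have := Real.add_one_le_exp (-c); linarith
    rw [h3, e]
    set E := Real.exp (-((1 - δ) * ((∑ j, x j + k : ℕ) - N) / B))
    have hE : 0 ≤ E * f z := mul_nonneg (Real.exp_pos _).le (h0 z)
    calc f z - (f (x + Pi.single i k) + marginal f (x + Pi.single i k) i)
        ≤ (1 - c) * (f z - f (x + Pi.single i k)) := by linarith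
      _ ≤ (1 - c) * (E * f z) := by
        have : 0 ≤ 1 - c := by linarith
        gcongr
      _ ≤ Real.exp (-c) * (E * f z) := by gcongr
      _ = E * Real.exp (-c) * f z := by ring

theorem GreedyInv.step (hf : DRSubmodular f) (hm : Monotone f) (h0 : ∀ x, 0 ≤ f x)
    {b : Fin n → ℕ} {B N : ℕ} {δ θ : ℝ} (hδ : 0 ≤ δ) (hδ1 : δ < 1) (hθ : 0 ≤ θ)
    {z x : Fin n → ℕ} (hz : z ∈ budgetFeasible b B) {i : Fin n} {k : ℕ}
    (h : GreedyInv f b B N δ z θ i x) (hB : ∑ j, x j + k ≤ B) (hw : Worth f θ x i k)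
    (hmax : ∀ t, x i + t ≤ b i → ∑ j, x j + t ≤ B → Worth f θ x i t → t ≤ k) :
    GreedyInv f b B N δ z θ (i + 1) (x + Pi.single i k) := by
  have hxk : x ≤ x + Pi.single i k := le_add_of_nonneg_right (fun j => Nat.zero_le _)
  refine ⟨?_, gap_add_single hf hm h0 hδ hδ1 hθ hz hB hw h.gap h.all, ?_, ?_⟩
  · rw [sum_add_single]
    exact h.start.trans (Nat.le_add_right _ _)
  · intro hs j hj
    rw [sum_add_single] at hs
    exact (marginal_anti hf hxk j).trans (h.all (by omega) j ((hxk j).trans_lt hj))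
  · intro hs j hji hj
    rw [sum_add_single] at hs
    rcases eq_or_ne j i with rfl | hne
    -- With room in both the bound and the budget, `k + 1` would have been admissible too.
    · by_contra! hlt
      have := hmax (k + 1) (by simp at hj; omega) (by omega) (worth_succ_iff.2 hlt.le)
      omega
    · have : (j : ℕ) < i := by
        have : (j : ℕ) ≠ i := fun h => hne (Fin.ext h)
        omega
      exact (marginal_anti hf hxk j).trans (h.done (by omega) j this ((hxk j).trans_lt hj))

/-- After a full sweep all usable marginals are at most θ, which is the new threshold divided by 1 -
δ. -/
theorem GreedyInv.next {b : Fin n → ℕ} {B N : ℕ} {δ θ : ℝ} (hδ1 : δ < 1)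
    {z x : Fin n → ℕ} (h : GreedyInv f b B N δ z θ n x) :
    GreedyInv f b B N δ z (θ * (1 - δ)) 0 x := by
  refine ⟨h.start, h.gap, fun hs j hj => ?_, fun _ j hj => absurd hj (Nat.not_lt_zero _)⟩
  rw [mul_div_cancel_right₀ _ (by linarith)]
  exact h.done hs j j.2 hj

/-- Here (1-δ)² ≥ 1 - 2δ and exp(2δ) ≤ 1/(1-2δ) ≤ 1 + 4δ. One factor 1 - δ comes from the ratio of
the thresholds, the other from the head start. -/
theorem exp_neg_sq_le {δ : ℝ} (hδ : 0 ≤ δ) (hδ1 : δ ≤ 1 / 4) :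
    Real.exp (-((1 - δ) * (1 - δ))) ≤ 1 / Real.exp 1 + 4 * δ := by
  have h1 : Real.exp (2 * δ) ≤ 1 + 4 * δ := by
    have := Real.exp_bound_div_one_sub_of_interval (x := 2 * δ) (by linarith) (by linarith)
    refine this.trans ?_
    rw [div_le_iff₀ (by linarith)]
    nlinarith
  have h2 : Real.exp (-((1 - δ) * (1 - δ))) ≤ Real.exp (-1) * Real.exp (2 * δ) := by
    rw [← Real.exp_add, Real.exp_le_exp]
    nlinarith
  have h3 : Real.exp (-1) ≤ 1 := Real.exp_le_one_iff.2 (by norm_num)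
  have h4 := Real.exp_pos (-1)
  rw [one_div, ← Real.exp_neg]
  nlinarith

/-- The guarantee of the threshold greedy algorithm when the thresholds have become negligible. -/
theorem GreedyInv.final (hf : DRSubmodular f) (hm : Monotone f) (h0 : ∀ x, 0 ≤ f x)
    {b : Fin n → ℕ} {B N : ℕ} {δ θ : ℝ} (hδ : 0 ≤ δ) (hδ1 : δ ≤ 1 / 4) (hθ : 0 ≤ θ)
    {z x : Fin n → ℕ} (hz : z ∈ budgetFeasible b B) {i : ℕ}
    (h : GreedyInv f b B N δ z θ i x) (hB : ∑ j, x j ≤ B) (hN : (N : ℝ) ≤ δ * B)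
    (hsmall : B * θ ≤ δ * f z) :
    (1 - 1 / Real.exp 1 - 4 * δ) * f z ≤ f x := by
  have he : 0 < 1 / Real.exp 1 := by positivity
  have hfz := h0 z
  rcases hB.lt_or_eq with hlt | heq
  -- Budget left over: every usable marginal is negligible.
  · have h1 := sub_le_of_marginal_le hf hm hz (div_nonneg hθ (by linarith)) (h.all hlt)
    have h2 : (B : ℝ) * (θ / (1 - δ)) ≤ 2 * δ * f z := by
      rw [mul_div_assoc', div_le_iff₀ (by linarith)]
      have : 0 ≤ δ * f z * (1 - 2 * δ) := by
        apply mul_nonneg (mul_nonneg hδ hfz); linarith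
      nlinarith
    have : 0 ≤ δ * f z := mul_nonneg hδ hfz
    have : 0 ≤ 1 / Real.exp 1 * f z := mul_nonneg he.le hfz
    linarith
  -- Budget exhausted: the exponential bound applies, with at least (1-δ)B units spent after the
  -- head start.
  · have h1 := h.gap
    rw [heq] at h1
    rcases Nat.eq_zero_or_pos B with rfl | hBpos
    · have hz0 : z = 0 := by
        funext j
        exact Finset.sum_eq_zero_iff.1 (Nat.le_zero.1 hz.2) j (Finset.mem_univ j)
      have : f z ≤ f x := hm (by rw [hz0]; intro j; simp)
      have : 0 ≤ δ * f z := mul_nonneg hδ hfz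
      have : 0 ≤ 1 / Real.exp 1 * f z := mul_nonneg he.le hfz
      linarith
    · have hBr : (0 : ℝ) < B := by exact_mod_cast hBpos
      have h2 : (1 - δ) * (1 - δ) ≤ (1 - δ) * ((B : ℝ) - N) / B := by
        rw [le_div_iff₀ hBr, mul_assoc]
        gcongr
        · linarith
        · linarith
      have h3 : Real.exp (-((1 - δ) * ((B : ℝ) - N) / B)) ≤ 1 / Real.exp 1 + 4 * δ :=
        (Real.exp_le_exp.2 (by linarith)).trans (exp_neg_sq_le hδ hδ1)
      have h4 := mul_le_mul_of_nonneg_right h3 hfz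
      linarith

end Marginal

namespace OracleRam

/-! ### A Hoare logic with step budgets. -/

section Logic

variable {n : ℕ} {f : (Fin n → ℕ) → ℝ}

/-- With the oracle `f`, the program `P` started in `s` halts within `T` steps in a memory that
satisfies `Q`. -/
def Runs (f : (Fin n → ℕ) → ℝ) (P : Program) (s : Store) (T : ℕ) (Q : Store → Prop) : Prop :=
  ∃ t s', Exec f P s t s' ∧ t ≤ T ∧ Q s'

theorem Runs.mono {P : Program} {s : Store} {T T' : ℕ} {Q Q' : Store → Prop}
    (h : Runs f P s T Q) (hT : T ≤ T') (hQ : ∀ s', Q s' → Q' s') : Runs f P s T' Q' := by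
  obtain ⟨t, s', he, ht, hq⟩ := h
  exact ⟨t, s', he, ht.trans hT, hQ _ hq⟩

theorem Runs.skip {s : Store} {T : ℕ} {Q : Store → Prop} (hT : 1 ≤ T) (hQ : Q s) :
    Runs f .skip s T Q := ⟨_, _, .skip s, hT, hQ⟩

theorem Runs.setNat {s : Store} {v : ℕ} {e : NatExpr} {T : ℕ} {Q : Store → Prop}
    (hT : e.cost + 1 ≤ T) (hQ : Q (s.setNat v (e.eval s))) : Runs f (.setNat v e) s T Q :=
  ⟨_, _, .setNat s v e, hT, hQ⟩

theorem Runs.setReal {s : Store} {v : ℕ} {e : RealExpr} {T : ℕ} {Q : Store → Prop}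
    (hT : e.cost + 1 ≤ T) (hQ : Q (s.setReal v (e.eval s))) : Runs f (.setReal v e) s T Q :=
  ⟨_, _, .setReal s v e, hT, hQ⟩

theorem Runs.putNat {s : Store} {a : ℕ} {i e : NatExpr} {T : ℕ} {Q : Store → Prop}
    (hT : i.cost + e.cost + 1 ≤ T) (hQ : Q (s.putNat a (i.eval s) (e.eval s))) :
    Runs f (.putNat a i e) s T Q :=
  ⟨_, _, .putNat s a i e, hT, hQ⟩

theorem Runs.query {s : Store} {v a : ℕ} {T : ℕ} {Q : Store → Prop}
    (hT : 1 ≤ T) (hQ : Q (s.setReal v (f (s.vec n a)))) : Runs f (.query v a) s T Q :=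
  ⟨_, _, .query s v a, hT, hQ⟩

/-- The run of the second program is the postcondition of the first, so proofs follow the program
text forwards. -/
theorem Runs.seq {P P' : Program} {s : Store} {T : ℕ} {Q : Store → Prop} (T₁ T₂ : ℕ)
    (hT : T₁ + T₂ ≤ T) (h : Runs f P s T₁ fun s' => Runs f P' s' T₂ Q) :
    Runs f (.seq P P') s T Q := by
  obtain ⟨t, s', he, ht, t', s'', he', ht', hq⟩ := h
  exact ⟨_, _, .seq he he', by omega, hq⟩

theorem Runs.branch {c : Test} {P P' : Program} {s : Store} {T : ℕ} {Q : Store → Prop} (T₁ : ℕ)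
    (hT : c.cost + 1 + T₁ ≤ T) (h : c.Holds s → Runs f P s T₁ Q)
    (h' : ¬ c.Holds s → Runs f P' s T₁ Q) : Runs f (.branch c P P') s T Q := by
  by_cases hc : c.Holds s
  · obtain ⟨t, s', he, ht, hq⟩ := h hc
    exact ⟨_, _, .branch_true hc he, by omega, hq⟩
  · obtain ⟨t, s', he, ht, hq⟩ := h' hc
    exact ⟨_, _, .branch_false hc he, by omega, hq⟩

/-- Loops, with an invariant that mentions the number of steps still available. -/
theorem Runs.loop {c : Test} {P : Program} {Q : Store → Prop} (I : ℕ → Store → Prop)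
    (hI : ∀ T s, I T s → (¬ c.Holds s ∧ c.cost + 1 ≤ T ∧ Q s) ∨
      (c.Holds s ∧ ∃ T₁ T₂, c.cost + 1 + T₁ + T₂ ≤ T ∧ Runs f P s T₁ (I T₂)))
    {T : ℕ} {s : Store} (h : I T s) : Runs f (.loop c P) s T Q := by
  -- The cost of the test makes the remaining budget drop strictly, so the budget also serves as
  -- termination measure.
  induction T using Nat.strong_induction_on generalizing s with
  | _ T ih =>
    rcases hI T s h with ⟨hc, hT, hq⟩ | ⟨hc, T₁, T₂, hT, t, s', he, ht, hi⟩
    · exact ⟨_, _, Exec.loop_stop hc, hT, hq⟩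
    · obtain ⟨t', s'', he', ht', hq⟩ := ih T₂ (by omega) hi
      exact ⟨_, _, .loop_step hc he he', by omega, hq⟩

end Logic

/-! Integer variables: `0` is `n`, `1` is `B`, `2` the current coordinate, `3` the result of a
search, `4` the current exponent, `5` the budget left, `6` the bound of a search, `7` the value
tried. Real variables: `0` is `ε`, `1` is `δ = ε / 4`, `2` the relative threshold, `3` the largest
marginal, `4` and `5` results of queries, `6` the threshold. Integer arrays: `0` is `b`, `1` the
current vector, `2` the powers of two. -/

/-! ### Programs for binary search and sweeps. -/

/-- Stores the powers of two up to the bound in variable `6`. -/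
def powersLoop : Program :=
  .loop (.natLe (.get 2 (.var 4)) (.var 6))
    (.seq (.putNat 2 (.add (.var 4) (.lit 1)) (.add (.get 2 (.var 4)) (.get 2 (.var 4))))
      (.setNat 4 (.add (.var 4) (.lit 1))))

/-- Determines the bits of the result, starting with the highest. -/
def bitsLoop (check : Program) (c : Test) : Program :=
  .loop (.natLe (.lit 1) (.var 4))
    (.seq (.setNat 4 (.sub (.var 4) (.lit 1))) <|
     .seq (.setNat 7 (.add (.var 3) (.get 2 (.var 4))))
      (.branch (.natLe (.var 7) (.var 6))
        (.seq check (.branch c (.setNat 3 (.var 7)) .skip)) .skip))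

/-- Finds the largest value up to the bound in variable `6` that passes the test. -/
def search (check : Program) (c : Test) : Program :=
  .seq (.setNat 3 (.lit 0)) <| .seq (.setNat 4 (.lit 0)) <| .seq (.putNat 2 (.lit 0) (.lit 1)) <|
  .seq powersLoop (bitsLoop check c)

/-- Raises each coordinate in turn as far as the bounds, the budget and the test allow. -/
def sweep (check : Program) (c : Test) : Program :=
  .seq (.setNat 2 (.lit 0)) <|
  .loop (.natLe (.add (.var 2) (.lit 1)) (.var 0)) <|
    .seq (.setNat 6 (.sub (.sub (.get 0 (.var 2)) (.get 1 (.var 2)))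
      (.sub (.sub (.get 0 (.var 2)) (.get 1 (.var 2))) (.var 5)))) <|
    .seq (search check c) <|
    .seq (.putNat 1 (.var 2) (.add (.get 1 (.var 2)) (.var 3))) <|
    .seq (.setNat 5 (.sub (.var 5) (.var 3)))
      (.setNat 2 (.add (.var 2) (.lit 1)))

/-- Queries the current vector with `t` and with `t - 1` units more in the current coordinate. -/
def worthCheck : Program :=
  .seq (.putNat 1 (.var 2) (.add (.get 1 (.var 2)) (.var 7))) <|
  .seq (.query 4 1) <|
  .seq (.putNat 1 (.var 2) (.sub (.get 1 (.var 2)) (.lit 1))) <|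
  .seq (.query 5 1)
    (.putNat 1 (.var 2) (.sub (.add (.get 1 (.var 2)) (.lit 1)) (.var 7)))

/-- The memories that a search may produce. -/
structure SearchFrame (s s' : Store) : Prop where
  natVar : ∀ v, v ≠ 3 → v ≠ 4 → v ≠ 7 → s'.natVar v = s.natVar v
  natArr : ∀ a, a ≠ 2 → s'.natArr a = s.natArr a
  realVar : ∀ v, v ≠ 4 → v ≠ 5 → s'.realVar v = s.realVar v

/-- The memories that a check may produce. -/
structure CheckFrame (s s' : Store) : Prop where
  natVar : s'.natVar = s.natVar
  natArr : s'.natArr = s.natArr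
  realVar : ∀ v, v ≠ 4 → v ≠ 5 → s'.realVar v = s.realVar v

theorem SearchFrame.check {s s' s'' : Store} (h : SearchFrame s s') (h' : CheckFrame s' s'') :
    SearchFrame s s'' :=
  ⟨fun v h3 h4 h7 => by rw [h'.natVar, h.natVar v h3 h4 h7],
   fun a ha => by rw [h'.natArr, h.natArr a ha],
   fun v h4 h5 => by rw [h'.realVar v h4 h5, h.realVar v h4 h5]⟩

theorem SearchFrame.setNat {s s' : Store} (h : SearchFrame s s') {v : ℕ} (k : ℕ)
    (hv : v = 3 ∨ v = 4 ∨ v = 7) : SearchFrame s (s'.setNat v k) :=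
  ⟨fun w h3 h4 h7 => by
    have : w ≠ v := by rintro rfl; tauto
    simp [Store.setNat, this, h.natVar w h3 h4 h7], h.natArr, h.realVar⟩

theorem SearchFrame.putNat {s s' : Store} (h : SearchFrame s s') (i k : ℕ) :
    SearchFrame s (s'.putNat 2 i k) :=
  ⟨h.natVar, fun a ha => by simp [Store.putNat, ha, h.natArr a ha], h.realVar⟩

theorem SearchFrame.refl (s : Store) : SearchFrame s s :=
  ⟨fun _ _ _ _ => rfl, fun _ _ => rfl, fun _ _ _ => rfl⟩

/-! ### Correctness and cost of search and sweep. -/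

section Specs

variable {n : ℕ} {f : (Fin n → ℕ) → ℝ}

/-- The machine cannot halve, so the powers are tabulated by doubling. The first one above the cap
has exponent `Nat.size`. -/
theorem powersLoop_runs {s₀ s : Store} (hF : SearchFrame s₀ s) (h3 : s.natVar 3 = 0)
    (h4 : s.natVar 4 = 0) (ha : s.natArr 2 0 = 1) :
    Runs f powersLoop s (18 * Nat.size (s₀.natVar 6) + 5) fun s' =>
      SearchFrame s₀ s' ∧ s'.natVar 3 = 0 ∧ s'.natVar 4 = Nat.size (s₀.natVar 6) ∧
        ∀ l ≤ Nat.size (s₀.natVar 6), s'.natArr 2 l = 2 ^ l := by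
  set L := Nat.size (s₀.natVar 6) with hL
  refine Runs.loop (fun T s' => SearchFrame s₀ s' ∧ s'.natVar 3 = 0 ∧ s'.natVar 4 ≤ L ∧
    (∀ l ≤ s'.natVar 4, s'.natArr 2 l = 2 ^ l) ∧ T = 18 * (L - s'.natVar 4) + 5) ?_
    ⟨hF, h3, by omega, by simp [h4, ha], by simp [h4]⟩
  rintro T s ⟨hF, h3, h4, hpow, rfl⟩
  have h6 : s.natVar 6 = s₀.natVar 6 := hF.natVar 6 (by simp) (by simp) (by simp)
  have hlt : s.natArr 2 (s.natVar 4) ≤ s.natVar 6 ↔ s.natVar 4 < L := by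
    rw [hpow _ le_rfl, h6, hL, Nat.lt_size]
  by_cases hc : s.natVar 4 < L
  · refine Or.inr ⟨hlt.2 hc, 13, 18 * (L - (s.natVar 4 + 1)) + 5, ?_, ?_⟩
    · simp [Test.cost, NatExpr.cost]; omega
    refine Runs.seq 9 4 le_rfl (Runs.putNat (by simp [NatExpr.cost]) ?_)
    refine Runs.setNat (by simp [NatExpr.cost]) ⟨(hF.putNat _ _).setNat _ (by simp), ?_⟩
    simp only [Store.setNat, Store.putNat, NatExpr.eval]
    refine ⟨by simp [h3], by simpa using hc, ?_, by simp⟩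
    intro l hl
    simp at hl
    rcases hl.lt_or_eq with hl | rfl
    · have : l ≠ s.natVar 4 + 1 := by omega
      simp [this, hpow l (by omega)]
    · simp [hpow _ le_rfl, pow_succ, mul_two]
  · refine Or.inl ⟨fun h => hc (hlt.1 h), by simp [Test.cost, NatExpr.cost], hF, h3, by omega, ?_⟩
    intro l hl
    exact hpow l (by omega)

/-- Invariant: the current result passes, and every passing value under the cap is below the result
plus 2^l, with l digits undecided. At l = 0 the result is the maximum. -/
theorem bitsLoop_runs {check : Program} {c : Test} {s₀ s : Store} {p : ℕ → Prop} {Tc L : ℕ}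
    (hp : ∀ t u, t ≤ u → p u → p t) (hp0 : p 0)
    (hcheck : ∀ s', SearchFrame s₀ s' → 1 ≤ s'.natVar 7 →
      Runs f check s' Tc fun s'' => CheckFrame s' s'' ∧ (c.Holds s'' ↔ p (s'.natVar 7)))
    (hF : SearchFrame s₀ s) (h3 : s.natVar 3 = 0) (h4 : s.natVar 4 = L)
    (ha : ∀ l ≤ L, s.natArr 2 l = 2 ^ l) (hL : s₀.natVar 6 < 2 ^ L) :
    Runs f (bitsLoop check c) s ((Tc + c.cost + 20) * L + 4) fun s' =>
      SearchFrame s₀ s' ∧ s'.natVar 3 ≤ s₀.natVar 6 ∧ p (s'.natVar 3) ∧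
        ∀ t ≤ s₀.natVar 6, p t → t ≤ s'.natVar 3 := by
  set cap := s₀.natVar 6 with hcap
  refine Runs.loop (fun T s' => SearchFrame s₀ s' ∧ s'.natVar 3 ≤ cap ∧ p (s'.natVar 3) ∧
    (∀ t ≤ cap, p t → t < s'.natVar 3 + 2 ^ s'.natVar 4) ∧ (∀ l ≤ s'.natVar 4, s'.natArr 2 l = 2 ^ l)
    ∧ T = (Tc + c.cost + 20) * s'.natVar 4 + 4) ?_
    ⟨hF, by omega, by rwa [h3], fun t ht _ => by rw [h3, h4]; omega, by rwa [h4], by rw [h4]⟩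
  rintro T s ⟨hF, h3, hk, hmax, hpow, rfl⟩
  have h6 : s.natVar 6 = cap := hF.natVar 6 (by simp) (by simp) (by simp)
  rcases Nat.eq_zero_or_pos (s.natVar 4) with h4 | h4
  · refine Or.inl ⟨?_, ?_, hF, h3, hk, ?_⟩
    · simp [Test.Holds, NatExpr.eval, h4]
    · simp [Test.cost, NatExpr.cost]
    · intro t ht hpt
      have := hmax t ht hpt
      simp [h4] at this
      omega
  obtain ⟨j, hj⟩ : ∃ j, s.natVar 4 = j + 1 := ⟨s.natVar 4 - 1, by omega⟩
  refine Or.inr ⟨h4, Tc + c.cost + 16, (Tc + c.cost + 20) * j + 4, ?_, ?_⟩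
  · rw [hj]
    simp only [Test.cost, NatExpr.cost]
    ring_nf
    omega
  refine Runs.seq 4 (Tc + c.cost + 12) (by omega) (Runs.setNat (by simp [NatExpr.cost]) ?_)
  refine Runs.seq 5 (Tc + c.cost + 7) (by omega) (Runs.setNat (by simp [NatExpr.cost]) ?_)
  set s₁ := ((s.setNat 4 _).setNat 7 _) with hs₁
  have hF₁ : SearchFrame s₀ s₁ := (hF.setNat _ (by simp)).setNat _ (by simp)
  have e3 : s₁.natVar 3 = s.natVar 3 := by simp [hs₁, Store.setNat]
  have e4 : s₁.natVar 4 = j := by simp [hs₁, Store.setNat, NatExpr.eval, hj]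
  have e6 : s₁.natVar 6 = cap := hF₁.natVar 6 (by simp) (by simp) (by simp)
  have e7 : s₁.natVar 7 = s.natVar 3 + 2 ^ j := by
    simp [hs₁, Store.setNat, NatExpr.eval, hj, hpow j (by omega)]
  have ea : ∀ l ≤ j, s₁.natArr 2 l = 2 ^ l := fun l hl => hpow l (by omega)
  -- A rejected candidate excludes all larger values, by downward closure of `p`.
  have hfail : ¬ (s.natVar 3 + 2 ^ j ≤ cap ∧ p (s.natVar 3 + 2 ^ j)) →
      ∀ t ≤ cap, p t → t < s.natVar 3 + 2 ^ j := by
    intro h t ht hpt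
    by_contra! hlt
    exact h ⟨hlt.trans ht, hp _ _ hlt hpt⟩
  have hpos := Nat.two_pow_pos j
  refine Runs.branch (Tc + c.cost + 3) (by simp [Test.cost, NatExpr.cost]; omega) ?_ ?_
  · intro hle
    simp only [Test.Holds, NatExpr.eval, e6, e7] at hle
    refine Runs.seq Tc (c.cost + 3) (by omega) ((hcheck s₁ hF₁ (by omega)).mono le_rfl ?_)
    rintro s₂ ⟨hC, hiff⟩
    rw [e7] at hiff
    have hF₂ := hF₁.check hC
    have g3 : s₂.natVar 3 = s.natVar 3 := by rw [hC.natVar, e3]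
    have g4 : s₂.natVar 4 = j := by rw [hC.natVar, e4]
    have g7 : s₂.natVar 7 = s.natVar 3 + 2 ^ j := by rw [hC.natVar, e7]
    have ga : ∀ l ≤ j, s₂.natArr 2 l = 2 ^ l := by rwa [hC.natArr]
    refine Runs.branch 2 (by omega) ?_ ?_
    · intro hc
      refine Runs.setNat (by simp [NatExpr.cost]) ⟨hF₂.setNat _ (by simp), ?_⟩
      simp only [Store.setNat, NatExpr.eval, Function.update_self, g7]
      refine ⟨hle, hiff.1 hc, ?_, ?_, ?_⟩
      · intro t ht hpt
        have := hmax t ht hpt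
        simp [g4]
        rw [hj, pow_succ] at this
        omega
      · simpa [g4] using ga
      · simp [g4]
    · intro hc
      refine Runs.skip (by omega) ⟨hF₂, by omega, by rwa [g3], ?_, by rwa [g4], by rw [g4]⟩
      rw [g3, g4]
      exact hfail fun h => hc (hiff.2 h.2)
  · intro hle
    simp only [Test.Holds, NatExpr.eval, e6, e7] at hle
    refine Runs.skip (by omega) ⟨hF₁, by omega, by rwa [e3], ?_, by rwa [e4], by rw [e4]⟩
    rw [e3, e4]
    exact hfail fun h => hle h.1

theorem search_runs {check : Program} {c : Test} {s : Store} {p : ℕ → Prop} {Tc : ℕ}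
    (hp : ∀ t u, t ≤ u → p u → p t) (hp0 : p 0)
    (hcheck : ∀ s', SearchFrame s s' → 1 ≤ s'.natVar 7 →
      Runs f check s' Tc fun s'' => CheckFrame s' s'' ∧ (c.Holds s'' ↔ p (s'.natVar 7))) :
    Runs f (search check c) s ((Tc + c.cost + 40) * (Nat.size (s.natVar 6) + 1)) fun s' =>
      SearchFrame s s' ∧ s'.natVar 3 ≤ s.natVar 6 ∧ p (s'.natVar 3) ∧
        ∀ t ≤ s.natVar 6, p t → t ≤ s'.natVar 3 := by
  set L := Nat.size (s.natVar 6) with hL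
  refine Runs.mono (T := 16 + (18 * L + (Tc + c.cost + 20) * L)) (Q := _) ?_
    (by ring_nf; omega) fun _ => id
  refine Runs.seq 2 (14 + (18 * L + (Tc + c.cost + 20) * L)) (by omega)
    (Runs.setNat (by simp [NatExpr.cost]) ?_)
  refine Runs.seq 2 (12 + (18 * L + (Tc + c.cost + 20) * L)) (by omega)
    (Runs.setNat (by simp [NatExpr.cost]) ?_)
  refine Runs.seq 3 (9 + (18 * L + (Tc + c.cost + 20) * L)) (by omega)
    (Runs.putNat (by simp [NatExpr.cost]) ?_)
  refine Runs.seq (18 * L + 5) ((Tc + c.cost + 20) * L + 4) (by omega)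
    ((powersLoop_runs (s₀ := s) ?_ ?_ ?_ ?_).mono le_rfl ?_)
  · exact (((SearchFrame.refl s).setNat _ (by simp)).setNat _ (by simp)).putNat _ _
  · simp [Store.setNat, Store.putNat, NatExpr.eval]
  · simp [Store.setNat, Store.putNat, NatExpr.eval]
  · simp [Store.setNat, Store.putNat, NatExpr.eval]
  · rintro s' ⟨hF, h3, h4, ha⟩
    exact bitsLoop_runs hp hp0 hcheck hF h3 h4 ha (Nat.lt_size_self _)

/-- The memory holds the input, the current vector `x` and the budget left; `ρ` gives the real
variables other than the results of queries. -/
structure Holding (b : Fin n → ℕ) (B : ℕ) (ρ : ℕ → ℝ) (x : Fin n → ℕ) (s : Store) : Prop where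
  size : s.natVar 0 = n
  budget : s.natVar 1 = B
  bounds : s.vec n 0 = b
  current : s.vec n 1 = x
  left : s.natVar 5 + ∑ j, x j = B
  le : x ≤ b
  real : ∀ v, v ≠ 4 → v ≠ 5 → s.realVar v = ρ v

theorem Holding.search {b : Fin n → ℕ} {B : ℕ} {ρ : ℕ → ℝ} {x : Fin n → ℕ} {s s' : Store}
    (h : Holding b B ρ x s) (hF : SearchFrame s s') : Holding b B ρ x s' where
  size := by rw [hF.natVar 0 (by simp) (by simp) (by simp), h.size]
  budget := by rw [hF.natVar 1 (by simp) (by simp) (by simp), h.budget]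
  bounds := by rw [← h.bounds]; funext j; simp [Store.vec, hF.natArr 0]
  current := by rw [← h.current]; funext j; simp [Store.vec, hF.natArr 1]
  left := by rw [hF.natVar 5 (by simp) (by simp) (by simp), h.left]
  le := h.le
  real v h4 h5 := by rw [hF.realVar v h4 h5, h.real v h4 h5]

theorem vec_eq (s : Store) (a : ℕ) : s.vec n a = fun i : Fin n => s.natArr a i := rfl

theorem vec_putNat (s : Store) (a k : ℕ) (i : Fin n) :
    (s.putNat a i k).vec n a = Function.update (s.vec n a) i k := by
  funext j
  rcases eq_or_ne j i with rfl | h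
  · simp [Store.vec, Store.putNat]
  · have : (j : ℕ) ≠ i := fun h' => h (Fin.ext h')
    simp [Store.vec, Store.putNat, h, this]

theorem update_add_eq (x : Fin n → ℕ) (i : Fin n) (k : ℕ) :
    Function.update x i (x i + k) = x + Pi.single i k := by
  funext j
  rcases eq_or_ne j i with rfl | h <;> simp [*]

/-- Serves both the head start and the threshold sweeps: `hstep` receives the chosen step together
with its maximality, which is all that either analysis needs. -/
theorem sweep_runs {check : Program} {c : Test} {b : Fin n → ℕ} {B : ℕ} {ρ : ℕ → ℝ}
    {p : (Fin n → ℕ) → Fin n → ℕ → Prop} {J : ℕ → (Fin n → ℕ) → Prop} {Tc : ℕ}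
    (hp : ∀ x i t u, t ≤ u → p x i u → p x i t) (hp0 : ∀ x i, p x i 0)
    (hcheck : ∀ x (i : Fin n) s, Holding b B ρ x s → s.natVar 2 = i → 1 ≤ s.natVar 7 →
      Runs f check s Tc fun s' => CheckFrame s s' ∧ (c.Holds s' ↔ p x i (s.natVar 7)))
    (hstep : ∀ (i : Fin n) x k, J i x → x i + k ≤ b i → ∑ j, x j + k ≤ B → p x i k →
      (∀ t, x i + t ≤ b i → ∑ j, x j + t ≤ B → p x i t → t ≤ k) → J (i + 1) (x + Pi.single i k))
    {x : Fin n → ℕ} {s : Store} (hH : Holding b B ρ x s) (hJ : J 0 x) :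
    Runs f (sweep check c) s ((Tc + c.cost + 80) * ∑ i, (Nat.size (b i) + 1) + 8) fun s' =>
      ∃ x', Holding b B ρ x' s' ∧ J n x' := by
  set A := Tc + c.cost + 80 with hA
  -- Extended by zero to ℕ, so that the remaining cost is an interval sum starting at the loop
  -- variable.
  set w : ℕ → ℕ := fun i => if h : i < n then Nat.size (b ⟨i, h⟩) + 1 else 0 with hw
  have hsum : ∑ i, (Nat.size (b i) + 1) = ∑ i ∈ Finset.Ico 0 n, w i := by
    rw [← Finset.range_eq_Ico, ← Fin.sum_univ_eq_sum_range]
    exact Finset.sum_congr rfl fun i _ => by simp [hw]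
  rw [hsum]
  refine Runs.seq 2 (A * (∑ i ∈ Finset.Ico 0 n, w i) + 6) (by omega)
    (Runs.setNat (by simp [NatExpr.cost]) ?_)
  refine Runs.loop (fun T s' => s'.natVar 2 ≤ n ∧ (∃ x', Holding b B ρ x' s' ∧ J (s'.natVar 2) x') ∧
    T = A * (∑ i ∈ Finset.Ico (s'.natVar 2) n, w i) + 6) ?_ ⟨?_, ⟨x, ?_, ?_⟩, ?_⟩
  · rintro T s ⟨hi, ⟨x, hH, hJ⟩, rfl⟩
    rcases hi.eq_or_lt with hi | hi
    · refine Or.inl ⟨?_, by simp [Test.cost, NatExpr.cost], x, hH, hi ▸ hJ⟩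
      simp [Test.Holds, NatExpr.eval, hH.size, hi]
    obtain ⟨i, hi'⟩ : ∃ i : Fin n, s.natVar 2 = i := ⟨⟨_, hi⟩, rfl⟩
    refine Or.inr ⟨?_, A * (Nat.size (b i) + 1) - 6, A * (∑ l ∈ Finset.Ico (i + 1 : ℕ) n, w l) + 6,
      ?_, ?_⟩
    · simp [Test.Holds, NatExpr.eval, hH.size]; omega
    · have : w i = Nat.size (b i) + 1 := by simp [hw]
      rw [hi', Finset.sum_eq_sum_Ico_succ_bot i.2, this, mul_add A (Nat.size (b i) + 1)]
      have : A ≤ A * (Nat.size (b i) + 1) := Nat.le_mul_of_pos_right _ (Nat.succ_pos _)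
      simp only [Test.cost, NatExpr.cost]
      omega
    set L := Nat.size (b i) with hL
    have hAL : A * (L + 1) = (Tc + c.cost + 40) * (L + 1) + 40 * (L + 1) := by rw [hA]; ring
    have hb : s.natArr 0 i = b i := congrFun hH.bounds i
    have hx : s.natArr 1 i = x i := congrFun hH.current i
    refine Runs.seq 14 ((Tc + c.cost + 40) * (L + 1) + 16) (by omega)
      (Runs.setNat (by simp [NatExpr.cost]) ?_)
    set s₁ := s.setNat 6 _ with hs₁
    have e2 : s₁.natVar 2 = i := by simp [hs₁, Store.setNat, hi']
    -- The form a - (a - c) is min(a, c) in truncated arithmetic: room under the bound and budget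
    -- left.
    have e6 : s₁.natVar 6 = (b i - x i) - ((b i - x i) - s.natVar 5) := by
      simp [hs₁, Store.setNat, NatExpr.eval, hi', hb, hx]
    have hH₁ : Holding b B ρ x s₁ :=
      ⟨by simpa [hs₁, Store.setNat] using hH.size, by simpa [hs₁, Store.setNat] using hH.budget,
        hH.bounds, hH.current, by simpa [hs₁, Store.setNat] using hH.left, hH.le, hH.real⟩
    have hsz : Nat.size (s₁.natVar 6) ≤ L := Nat.size_le_size (by rw [e6]; omega)
    refine Runs.seq ((Tc + c.cost + 40) * (L + 1)) 16 (by omega)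
      ((search_runs (Tc := Tc) (hp x i) (hp0 x i) ?_).mono (by gcongr) ?_)
    · intro s' hF h7
      exact hcheck x i s' (hH₁.search hF)
        (by rw [hF.natVar 2 (by simp) (by simp) (by simp), e2]) h7
    rintro s₂ ⟨hF, hle, hpk, hmax⟩
    have hH₂ := hH₁.search hF
    have g2 : s₂.natVar 2 = i := by rw [hF.natVar 2 (by simp) (by simp) (by simp), e2]
    have g5 : s₂.natVar 5 + ∑ j, x j = B := hH₂.left
    have g5' : s.natVar 5 + ∑ j, x j = B := hH.left
    have gx : s₂.natArr 1 i = x i := congrFun hH₂.current i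
    have hxb : x i ≤ b i := hH.le i
    set k := s₂.natVar 3 with hk
    rw [e6] at hle hmax
    refine Runs.seq 6 10 (by omega) (Runs.putNat (by simp [NatExpr.cost]) ?_)
    refine Runs.seq 4 6 (by omega) (Runs.setNat (by simp [NatExpr.cost]) ?_)
    refine Runs.setNat (by simp [NatExpr.cost]) ⟨?_, ⟨x + Pi.single i k, ⟨?_, ?_, ?_, ?_, ?_, ?_, ?_⟩, ?_⟩, ?_⟩
    · simp [Store.setNat, Store.putNat, NatExpr.eval, g2]
    · simpa [Store.setNat, Store.putNat] using hH₂.size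
    · simpa [Store.setNat, Store.putNat] using hH₂.budget
    · rw [← hH₂.bounds]
      funext j
      simp [Store.vec, Store.setNat, Store.putNat]
    · have := vec_putNat s₂ 1 (x i + k) i
      rw [hH₂.current, update_add_eq] at this
      simpa [vec_eq, Store.setNat, NatExpr.eval, Store.putNat, g2, gx, hk] using this
    · rw [sum_add_single]
      simp [Store.setNat, Store.putNat, NatExpr.eval, ← hk]
      omega
    · intro j
      rcases eq_or_ne j i with rfl | h
      · simp; omega
      · simpa [h] using hH.le j
    · exact hH₂.real
    · have : J (i + 1) (x + Pi.single i k) := hstep i x k (hi' ▸ hJ) (by omega) (by omega) hpk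
        fun t h1 h2 h3 => hmax t (by omega) h3
      simpa [Store.setNat, Store.putNat, NatExpr.eval, g2] using this
    · simp [Store.setNat, Store.putNat, NatExpr.eval, g2]
  · simp [Store.setNat, NatExpr.eval]
  · exact ⟨by simpa [Store.setNat] using hH.size, by simpa [Store.setNat] using hH.budget,
        hH.bounds, hH.current, by simpa [Store.setNat] using hH.left, hH.le, hH.real⟩
  · simpa [Store.setNat, NatExpr.eval] using hJ
  · simp [Store.setNat, NatExpr.eval]

/-- The vector is altered in place. Restoring it needs `1 ≤ s.natVar 7`: trying 0 on a zero cell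
would leave 1 there, because of truncation. -/
theorem worthCheck_runs {b : Fin n → ℕ} {B : ℕ} {ρ : ℕ → ℝ} {x : Fin n → ℕ} {i : Fin n} {s : Store}
    (hH : Holding b B ρ x s) (h2 : s.natVar 2 = i) (h7 : 1 ≤ s.natVar 7) :
    Runs f worthCheck s 22 fun s' => CheckFrame s s' ∧
      ((Test.realLe (.var 6) (.sub (.var 4) (.var 5))).Holds s' ↔
        Worth f (ρ 6) x i (s.natVar 7)) := by
  set t := s.natVar 7 with ht
  have hx : s.natArr 1 i = x i := congrFun hH.current i
  have hv : ∀ k, (s.putNat 1 i (x i + k)).vec n 1 = x + Pi.single i k := fun k => by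
    rw [vec_putNat, hH.current, update_add_eq]
  refine Runs.seq 6 16 le_rfl (Runs.putNat (by simp [NatExpr.cost]) ?_)
  refine Runs.seq 1 15 le_rfl (Runs.query le_rfl ?_)
  refine Runs.seq 6 9 le_rfl (Runs.putNat (by simp [NatExpr.cost]) ?_)
  refine Runs.seq 1 8 le_rfl (Runs.query le_rfl ?_)
  refine Runs.putNat (by simp [NatExpr.cost]) ⟨⟨?_, ?_, ?_⟩, ?_⟩
  · rfl
  · simp [Store.putNat, Store.setReal, NatExpr.eval, h2, hx, ← ht]
    omega
  · intro v h4 h5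
    simp [Store.putNat, Store.setReal, h4, h5]
  · have h1 := hv t
    have h2' := hv (t - 1)
    have h0 : t ≠ 0 := by omega
    have e : x i + t - 1 = x i + (t - 1) := by omega
    simp [Store.putNat, vec_eq] at h1 h2'
    simp [Store.putNat, Store.setReal, NatExpr.eval, h2, hx, ← ht, Test.Holds, RealExpr.eval,
      vec_eq, Worth, h0, e, h1, h2', hH.real 6]

end Specs

end OracleRam

namespace OracleRam

/-! ### The algorithm. -/

/-- The test for the initial vector: `t * n ≤ δ * B`. -/
def freeTest : Test :=
  .realLe (.mul (.ofNat (.var 7)) (.ofNat (.var 0))) (.mul (.var 1) (.ofNat (.var 1)))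

/-- The test that a marginal is at least the threshold. -/
def worthTest : Test := .realLe (.var 6) (.sub (.var 4) (.var 5))

/-- Queries one coordinate raised by one and updates the largest marginal. -/
def tryMarginal : Program :=
  .seq (.putNat 1 (.var 2) (.add (.get 1 (.var 2)) (.lit 1))) <|
  .seq (.query 5 1) <|
  .seq (.putNat 1 (.var 2) (.sub (.get 1 (.var 2)) (.lit 1)))
    (.branch (.realLe (.var 3) (.sub (.var 5) (.var 4))) (.setReal 3 (.sub (.var 5) (.var 4))) .skip)

/-- Computes the largest marginal at the current vector among the coordinates below their bounds. -/
def maxMarginal : Program :=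
  .seq (.query 4 1) <| .seq (.setNat 2 (.lit 0)) <| .seq (.setReal 3 (.ofNat (.lit 0))) <|
  .loop (.natLe (.add (.var 2) (.lit 1)) (.var 0)) <|
    .seq (.branch (.natLe (.add (.get 1 (.var 2)) (.lit 1)) (.get 0 (.var 2))) tryMarginal .skip)
      (.setNat 2 (.add (.var 2) (.lit 1)))

/-- Sweeps with geometrically decreasing thresholds. -/
def thresholdLoop : Program :=
  .loop (.neg (.realLe (.var 2) (.div (.mul (.var 1) (.var 1)) (.ofNat (.var 0))))) <|
    .seq (.setReal 6 (.mul (.var 3) (.var 2))) <|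
    .seq (sweep worthCheck worthTest)
      (.setReal 2 (.mul (.var 2) (.sub (.ofNat (.lit 1)) (.var 1))))

/-- The threshold greedy algorithm with a head start of at most `δ * B` units. -/
def thresholdGreedy : Program :=
  .seq (.setReal 1 (.div (.var 0) (.ofNat (.lit 4)))) <|
  .seq (.setNat 5 (.var 1)) <|
  .seq (sweep .skip freeTest) <|
  .seq maxMarginal <|
  .seq (.setReal 2 (.ofNat (.lit 1))) thresholdLoop

/-! ### Correctness and cost of the algorithm. -/

section Specs

variable {n : ℕ} {f : (Fin n → ℕ) → ℝ} {b : Fin n → ℕ} {B : ℕ}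

/-- The total number of bits of the bounds, and one more for each. -/
def bitSize (b : Fin n → ℕ) : ℕ := ∑ i, (Nat.size (b i) + 1)

theorem le_bitSize (b : Fin n → ℕ) : n ≤ bitSize b := by
  simp [bitSize, Finset.sum_add_distrib]

/-- What is known of the initial vector after its first `i` coordinates have been set. -/
structure FreeInv (b : Fin n → ℕ) (B : ℕ) (δ : ℝ) (i : ℕ) (x : Fin n → ℕ) : Prop where
  small : ((∑ j, x j : ℕ) : ℝ) * n ≤ i * (δ * B)
  zero : ∀ j : Fin n, i ≤ j → x j = 0
  large : ∑ j, x j < B → ∀ j : Fin n, (j : ℕ) < i → x j < b j → δ * B ≤ ((x j : ℝ) + 1) * n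

theorem FreeInv.step {δ : ℝ} {x : Fin n → ℕ} {i : Fin n} {k : ℕ} (h : FreeInv b B δ i x)
    (hk : (k : ℝ) * n ≤ δ * B)
    (hmax : ∀ t : ℕ, x i + t ≤ b i → ∑ j, x j + t ≤ B → (t : ℝ) * n ≤ δ * B → t ≤ k) :
    FreeInv b B δ (i + 1) (x + Pi.single i k) := by
  refine ⟨?_, ?_, ?_⟩
  · rw [sum_add_single]
    have := h.small
    push_cast at this ⊢
    linarith
  · intro j hj
    have : j ≠ i := by rintro rfl; omega
    simp [this, h.zero j (by omega)]
  · intro hs j hj hjb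
    rw [sum_add_single] at hs
    rcases eq_or_ne j i with rfl | hne
    · have h0 := h.zero j le_rfl
      simp [h0] at hjb ⊢
      -- The coordinate was zero before this step, so `k` is its final value, and maximality of `k`
      -- rules out a quota that admits `k + 1`.
      by_contra! hlt
      have := hmax (k + 1) (by omega) (by omega) (by push_cast; linarith)
      omega
    · have : (j : ℕ) ≠ i := fun h => hne (Fin.ext h)
      simp [hne] at hjb ⊢
      exact h.large (by omega) j (by omega) hjb

/-- Reals cannot be rounded to integers on this machine, so the quota ⌊δB/n⌋ is found by the same
search, without oracle calls. -/
theorem freeSweep_runs {s : Store} (hδ : 0 ≤ s.realVar 1) (hH : Holding b B s.realVar 0 s) :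
    Runs f (sweep .skip freeTest) s (91 * bitSize b + 8) fun s' => ∃ x,
      Holding b B s.realVar x s' ∧ FreeInv b B (s.realVar 1) n x := by
  refine sweep_runs (Tc := 1) (p := fun _ _ t => (t : ℝ) * n ≤ s.realVar 1 * B)
    (J := FreeInv b B (s.realVar 1)) ?_ ?_ ?_ ?_ hH ?_
  · intro _ _ t u htu h
    refine le_trans ?_ h
    gcongr
  · intro _ _
    simpa using mul_nonneg hδ (Nat.cast_nonneg B)
  · intro x i s' h' _ _
    refine Runs.skip le_rfl ⟨⟨rfl, rfl, fun _ _ _ => rfl⟩, ?_⟩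
    simp [freeTest, Test.Holds, RealExpr.eval, NatExpr.eval, h'.size, h'.budget, h'.real 1]
  · intro i x k h _ _ hk hmax
    exact h.step hk hmax
  · exact ⟨by simp, fun _ _ => rfl, fun _ j hj => absurd hj (Nat.not_lt_zero _)⟩

theorem Holding.of_natEq {ρ ρ' : ℕ → ℝ} {x : Fin n → ℕ} {s s' : Store} (h : Holding b B ρ x s)
    (h0 : s'.natVar 0 = s.natVar 0) (h1 : s'.natVar 1 = s.natVar 1)
    (h5 : s'.natVar 5 = s.natVar 5) (ha0 : s'.vec n 0 = s.vec n 0) (ha1 : s'.vec n 1 = s.vec n 1)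
    (hr : ∀ v, v ≠ 4 → v ≠ 5 → s'.realVar v = ρ' v) : Holding b B ρ' x s' :=
  ⟨by rw [h0, h.size], by rw [h1, h.budget], by rw [ha0, h.bounds], by rw [ha1, h.current],
    by rw [h5, h.left], h.le, hr⟩

/-- `D` is the largest marginal at `x` among the first `i` coordinates, if they are below their
bounds. -/
structure IsMaxMarginal (f : (Fin n → ℕ) → ℝ) (b x : Fin n → ℕ) (i : ℕ) (D : ℝ) : Prop where
  nonneg : 0 ≤ D
  le : ∀ j : Fin n, (j : ℕ) < i → x j < b j → marginal f x j ≤ D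
  attained : D = 0 ∨ ∃ j, x j < b j ∧ D = marginal f x j

theorem tryMarginal_runs {ρ : ℕ → ℝ} {x : Fin n → ℕ} {i : Fin n} {s : Store}
    (hH : Holding b B ρ x s) (h2 : s.natVar 2 = i) (h4 : s.realVar 4 = f x) :
    Runs f tryMarginal s 26 fun s' => s'.natVar = s.natVar ∧ s'.natArr = s.natArr ∧
      (∀ v, v ≠ 3 → v ≠ 5 → s'.realVar v = s.realVar v) ∧
      s'.realVar 3 = max (s.realVar 3) (marginal f x i) := by
  have hx : s.natArr 1 i = x i := congrFun hH.current i
  have hv := vec_putNat s 1 (x i + 1) i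
  rw [hH.current, update_add_eq] at hv
  refine Runs.seq 6 20 le_rfl (Runs.putNat (by simp [NatExpr.cost]) ?_)
  refine Runs.seq 1 19 le_rfl (Runs.query le_rfl ?_)
  refine Runs.seq 6 13 le_rfl (Runs.putNat (by simp [NatExpr.cost]) ?_)
  set s₁ := (Store.setReal _ _ _).putNat _ _ _ with hs₁
  have e1 : s₁.natVar = s.natVar := rfl
  have e2 : s₁.natArr = s.natArr := by
    simp [hs₁, Store.putNat, Store.setReal, NatExpr.eval, h2]
  have e3 : s₁.realVar = Function.update s.realVar 5 (f (x + Pi.single i 1)) := by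
    simp [hs₁, Store.putNat, Store.setReal, NatExpr.eval, h2, hx, vec_eq]
    simp [Store.putNat, vec_eq] at hv
    rw [hv]
  refine Runs.branch 5 (by simp [Test.cost, RealExpr.cost]) ?_ ?_
  · intro hc
    simp [Test.Holds, RealExpr.eval, e3, h4] at hc
    refine Runs.setReal (by simp [RealExpr.cost]) ⟨e1, e2, ?_, ?_⟩
    · intro v h3 h5
      simp [Store.setReal, h3, h5, e3]
    · simp [Store.setReal, RealExpr.eval, e3, h4, marginal, hc]
  · intro hc
    simp [Test.Holds, RealExpr.eval, e3, h4] at hc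
    refine Runs.skip (by omega) ⟨e1, e2, ?_, ?_⟩
    · intro v h3 h5
      simp [h5, e3]
    · simp [e3, marginal, hc.le]

theorem maxMarginal_runs {x : Fin n → ℕ} {s : Store} (hH : Holding b B s.realVar x s) :
    Runs f maxMarginal s (60 * n + 20) fun s' => Holding b B s'.realVar x s' ∧
      s'.realVar 1 = s.realVar 1 ∧ IsMaxMarginal f b x n (s'.realVar 3) := by
  refine Runs.seq 1 (60 * n + 19) (by omega) (Runs.query le_rfl ?_)
  refine Runs.seq 2 (60 * n + 17) (by omega) (Runs.setNat (by simp [NatExpr.cost]) ?_)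
  -- Starting the maximum at 0 covers the case that every coordinate is at its bound.
  refine Runs.seq 3 (60 * n + 14) (by omega)
    (Runs.setReal (by simp [RealExpr.cost, NatExpr.cost]) ?_)
  refine Runs.loop (fun T s' => s'.natVar 2 ≤ n ∧ Holding b B s'.realVar x s' ∧
    s'.realVar 1 = s.realVar 1 ∧ s'.realVar 4 = f x ∧
    IsMaxMarginal f b x (s'.natVar 2) (s'.realVar 3) ∧ T = 60 * (n - s'.natVar 2) + 14) ?_
    ⟨?_, ?_, ?_, ?_, ?_, ?_⟩
  · rintro T s ⟨hi, hH, h1, h4, hD, rfl⟩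
    rcases hi.eq_or_lt with hi | hi
    · refine Or.inl ⟨?_, by simp [Test.cost, NatExpr.cost], hH, h1, hi ▸ hD⟩
      simp [Test.Holds, NatExpr.eval, hH.size, hi]
    obtain ⟨i, hi'⟩ : ∃ i : Fin n, s.natVar 2 = i := ⟨⟨_, hi⟩, rfl⟩
    refine Or.inr ⟨?_, 50, 60 * (n - (i + 1)) + 14, ?_, ?_⟩
    · simp [Test.Holds, NatExpr.eval, hH.size]; omega
    · simp [Test.cost, NatExpr.cost]; omega
    have hx : s.natArr 1 i = x i := congrFun hH.current i
    have hb : s.natArr 0 i = b i := congrFun hH.bounds i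
    refine Runs.seq 40 10 le_rfl (Runs.branch 26 (by simp [Test.cost, NatExpr.cost]) ?_ ?_)
    · intro hc
      simp [Test.Holds, NatExpr.eval, hi', hx, hb] at hc
      refine (tryMarginal_runs hH hi' h4).mono le_rfl ?_
      rintro s' ⟨g1, g2, g3, g4⟩
      refine Runs.setNat (by simp [NatExpr.cost]) ⟨?_, ?_, ?_, ?_, ?_, ?_⟩
      · simp [Store.setNat, NatExpr.eval, g1, hi']
      · refine hH.of_natEq ?_ ?_ ?_ ?_ ?_ (fun _ _ _ => rfl) <;>
          simp [Store.setNat, g1, g2, vec_eq]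
      · simp [Store.setNat, g3, h1]
      · simp [Store.setNat, g3, h4]
      · simp [Store.setNat, NatExpr.eval, g1, g4, hi']
        refine ⟨hD.nonneg.trans (le_max_left _ _), ?_, ?_⟩
        · intro j hj hjb
          rcases eq_or_ne j i with rfl | hne
          · exact le_max_right _ _
          · have : (j : ℕ) ≠ i := fun h => hne (Fin.ext h)
            exact (hD.le j (by omega) hjb).trans (le_max_left _ _)
        · rcases max_choice (s.realVar 3) (marginal f x i) with h | h <;> rw [h]
          · exact hD.attained
          · exact Or.inr ⟨i, hc, rfl⟩
      · simp [Store.setNat, NatExpr.eval, g1, hi']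
    · intro hc
      simp [Test.Holds, NatExpr.eval, hi', hx, hb] at hc
      refine Runs.skip (by omega) (Runs.setNat (by simp [NatExpr.cost]) ⟨?_, ?_, h1, h4, ?_, ?_⟩)
      · simp [Store.setNat, NatExpr.eval, hi']
      · refine hH.of_natEq ?_ ?_ ?_ ?_ ?_ (fun _ _ _ => rfl) <;> simp [Store.setNat, vec_eq]
      · simp [Store.setNat, NatExpr.eval, hi']
        refine ⟨hD.nonneg, fun j hj hjb => ?_, hD.attained⟩
        have : (j : ℕ) ≠ i := by
          intro h
          rw [Fin.ext h] at hjb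
          omega
        exact hD.le j (by omega) hjb
      · simp [Store.setNat, NatExpr.eval, hi']
  · simp [Store.setNat, Store.setReal, NatExpr.eval]
  · refine hH.of_natEq ?_ ?_ ?_ ?_ ?_ (fun _ _ _ => rfl) <;>
      simp [Store.setNat, Store.setReal, vec_eq]
  · simp [Store.setNat, Store.setReal]
  · simp [Store.setNat, Store.setReal, hH.current]
  · simp [Store.setNat, Store.setReal, NatExpr.eval, RealExpr.eval]
    exact ⟨le_rfl, fun j hj => absurd hj (Nat.not_lt_zero _), Or.inl rfl⟩
  · simp [Store.setNat, Store.setReal, NatExpr.eval]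

theorem worthSweep_runs (hf : DRSubmodular f) (hm : Monotone f) (h0 : ∀ x, 0 ≤ f x) {N : ℕ} {δ : ℝ}
    (hδ : 0 ≤ δ) (hδ1 : δ < 1) {x z : Fin n → ℕ} (hz : z ∈ budgetFeasible b B) {s : Store}
    (hθ : 0 ≤ s.realVar 6) (hH : Holding b B s.realVar x s)
    (hJ : GreedyInv f b B N δ z (s.realVar 6) 0 x) :
    Runs f (sweep worthCheck worthTest) s (107 * bitSize b + 8) fun s' => ∃ x',
      Holding b B s.realVar x' s' ∧ GreedyInv f b B N δ z (s.realVar 6) n x' :=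
  sweep_runs (Tc := 22) (p := Worth f (s.realVar 6)) (J := GreedyInv f b B N δ z (s.realVar 6))
    (fun _ _ _ _ htu h => h.anti hf htu) (fun _ _ => Or.inl rfl)
    (fun _ _ _ hH h2 h7 => worthCheck_runs hH h2 h7)
    (fun _ _ _ h _ hB hw hmax => h.step hf hm h0 hδ hδ1 hθ hz hB hw hmax) hH hJ

/-- The program tests the relative threshold against δ²/n directly; `K` exists only in the proof, to
bound the number of sweeps. -/
theorem thresholdLoop_runs (hf : DRSubmodular f) (hm : Monotone f) (h0 : ∀ x, 0 ≤ f x) {N K : ℕ}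
    {δ D : ℝ} (hδ : 0 ≤ δ) (hδ1 : δ < 1) (hD : 0 ≤ D) (hK : (1 - δ) ^ K ≤ δ * δ / n)
    {x z : Fin n → ℕ} (hz : z ∈ budgetFeasible b B) {s : Store} (hr1 : s.realVar 1 = δ)
    (hr2 : s.realVar 2 = 1) (hr3 : s.realVar 3 = D) (hH : Holding b B s.realVar x s)
    (hJ : GreedyInv f b B N δ z D 0 x) :
    Runs f thresholdLoop s ((107 * bitSize b + 40) * K + 10) fun s' => ∃ x' θ,
      0 ≤ θ ∧ θ ≤ D * (δ * δ / n) ∧ Holding b B s'.realVar x' s' ∧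
        GreedyInv f b B N δ z θ 0 x' := by
  have hδ' : 0 ≤ 1 - δ := by linarith
  refine Runs.loop (fun T s' => ∃ k x', Holding b B s'.realVar x' s' ∧ s'.realVar 1 = δ ∧
    s'.realVar 2 = (1 - δ) ^ k ∧ s'.realVar 3 = D ∧ GreedyInv f b B N δ z (D * (1 - δ) ^ k) 0 x' ∧
    T = (107 * bitSize b + 40) * (K - k) + 10) ?_
    ⟨0, x, hH, hr1, by simpa using hr2, hr3, by simpa using hJ, by simp⟩
  rintro T s ⟨k, x, hH, h1, h2, h3, hJ, rfl⟩
  have hc : (Test.neg (.realLe (.var 2) (.div (.mul (.var 1) (.var 1)) (.ofNat (.var 0))))).Holds s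
      ↔ ¬ (1 - δ) ^ k ≤ δ * δ / n := by
    simp [Test.Holds, RealExpr.eval, NatExpr.eval, h1, h2, hH.size]
  by_cases hk : (1 - δ) ^ k ≤ δ * δ / n
  · refine Or.inl ⟨fun h => hc.1 h hk, by simp [Test.cost, RealExpr.cost, NatExpr.cost], x,
      D * (1 - δ) ^ k, by positivity, by gcongr, hH, hJ⟩
  have hkK : k < K := by
    by_contra! h
    exact hk ((pow_le_pow_of_le_one hδ' (by linarith) h).trans hK)
  refine Or.inr ⟨hc.2 hk, 107 * bitSize b + 19, (107 * bitSize b + 40) * (K - (k + 1)) + 10, ?_, ?_⟩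
  · obtain ⟨l, rfl⟩ : ∃ l, K = k + 1 + l := ⟨K - (k + 1), by omega⟩
    have e1 : k + 1 + l - (k + 1) = l := by omega
    have e2 : k + 1 + l - k = l + 1 := by omega
    rw [e1, e2, mul_add _ l 1]
    simp only [Test.cost, RealExpr.cost, NatExpr.cost]
    omega
  refine Runs.seq 4 (107 * bitSize b + 15) (by omega) (Runs.setReal (by simp [RealExpr.cost]) ?_)
  set s₁ := s.setReal 6 _ with hs₁
  have e6 : s₁.realVar 6 = D * (1 - δ) ^ k := by simp [hs₁, Store.setReal, RealExpr.eval, h2, h3]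
  have hH₁ : Holding b B s₁.realVar x s₁ := by
    refine hH.of_natEq ?_ ?_ ?_ ?_ ?_ (fun _ _ _ => rfl) <;> simp [hs₁, Store.setReal, vec_eq]
  refine Runs.seq (107 * bitSize b + 8) 7 (by omega)
    ((worthSweep_runs hf hm h0 hδ hδ1 hz (by rw [e6]; positivity) hH₁ (e6 ▸ hJ)).mono le_rfl ?_)
  rintro s₂ ⟨x', hH₂, hJ₂⟩
  rw [e6] at hJ₂
  have g1 : s₂.realVar 1 = δ := by
    rw [hH₂.real 1 (by simp) (by simp)]; simp [hs₁, Store.setReal, h1]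
  have g2 : s₂.realVar 2 = (1 - δ) ^ k := by
    rw [hH₂.real 2 (by simp) (by simp)]; simp [hs₁, Store.setReal, h2]
  have g3 : s₂.realVar 3 = D := by
    rw [hH₂.real 3 (by simp) (by simp)]; simp [hs₁, Store.setReal, h3]
  refine Runs.setReal (by simp [RealExpr.cost, NatExpr.cost]) ⟨k + 1, x', ?_, ?_, ?_, ?_, ?_, rfl⟩
  · refine hH₂.of_natEq ?_ ?_ ?_ ?_ ?_ (fun _ _ _ => rfl) <;> simp [Store.setReal, vec_eq]
  · simp [Store.setReal, g1]
  · simp [Store.setReal, RealExpr.eval, NatExpr.eval, g1, g2, pow_succ]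
  · simp [Store.setReal, g3]
  · rw [pow_succ, ← mul_assoc]
    exact hJ₂.next hδ1

/-- The largest marginal after the head start, compared with any optimal vector. -/
theorem mul_maxMarginal_le (hf : DRSubmodular f) (h0 : ∀ x, 0 ≤ f x) {δ D : ℝ}
    (hδ1 : δ < 1) {x z : Fin n → ℕ} (hxb : x ≤ b) (hI : FreeInv b B δ n x)
    (hxB : ((∑ j, x j : ℕ) : ℝ) ≤ δ * B) (hD : IsMaxMarginal f b x n D)
    (hz : ∀ y ∈ budgetFeasible b B, f y ≤ f z) : δ * (B * D) ≤ n * f z := by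
  have hnz : 0 ≤ n * f z := mul_nonneg (Nat.cast_nonneg _) (h0 z)
  rcases Nat.eq_zero_or_pos B with rfl | hB
  · simpa using hnz
  have hBr : (0 : ℝ) < B := by exact_mod_cast hB
  -- The head start leaves budget, so one more unit is feasible and `hI.large` applies.
  have hlt : ∑ j, x j < B := by
    have : ((∑ j, x j : ℕ) : ℝ) < B := by nlinarith
    exact_mod_cast this
  rcases hD.attained with hD0 | ⟨i, hi, hDi⟩
  · simpa [hD0] using hnz
  have h1 := succ_mul_marginal_le hf h0 x i
  have h2 : f (x + Pi.single i 1) ≤ f z := by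
    refine hz _ ⟨fun j => ?_, by rw [sum_add_single]; omega⟩
    rcases eq_or_ne j i with rfl | h
    · simp; omega
    · simpa [h] using hxb j
  have h3 := hI.large hlt i i.2 hi
  rw [← hDi] at h1
  calc δ * (B * D) = δ * B * D := by ring
    _ ≤ (((x i : ℝ) + 1) * n) * D := mul_le_mul_of_nonneg_right h3 hD.nonneg
    _ = n * (((x i : ℝ) + 1) * D) := by ring
    _ ≤ n * f z := by
      have := h1.trans h2
      gcongr

theorem exists_isMaxOn_budgetFeasible (f : (Fin n → ℕ) → ℝ) (b : Fin n → ℕ) (B : ℕ) :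
    ∃ z ∈ budgetFeasible b B, ∀ y ∈ budgetFeasible b B, f y ≤ f z := by
  have hfin : (budgetFeasible b B).Finite := (Set.finite_Iic b).subset fun _ h => h.1
  exact Set.exists_max_image _ f hfin ⟨0, fun _ => Nat.zero_le _, by simp⟩

theorem thresholdGreedy_runs (hf : DRSubmodular f) (hm : Monotone f) (h0 : ∀ x, 0 ≤ f x)
    (hn : 1 ≤ n) {ε : ℝ} (hε : 0 < ε) (hε1 : ε < 1) {K : ℕ}
    (hK : (1 - ε / 4) ^ K ≤ ε / 4 * (ε / 4) / n) {z : Fin n → ℕ} (hz : z ∈ budgetFeasible b B)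
    (hzmax : ∀ y ∈ budgetFeasible b B, f y ≤ f z) :
    Runs f thresholdGreedy (input b B ε) (300 * (bitSize b * (K + 1))) fun s =>
      output n s ∈ budgetFeasible b B ∧ (1 - 1 / Real.exp 1 - ε) * f z ≤ f (output n s) := by
  have hnS := le_bitSize b
  set S := bitSize b
  set δ := ε / 4 with hδdef
  have hδ : 0 < δ := by positivity
  have hδ1 : δ ≤ 1 / 4 := by linarith
  have hnr : (0 : ℝ) < n := by exact_mod_cast hn
  have hSK : S * (K + 1) = S * K + S := by ring
  have hKS : K ≤ S * K := Nat.le_mul_of_pos_left _ (by omega)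
  have hmul : (107 * S + 40) * K = 107 * (S * K) + 40 * K := by ring
  refine Runs.seq 5 (300 * (S * (K + 1)) - 5) (by omega)
    (Runs.setReal (by simp [RealExpr.cost, NatExpr.cost]) ?_)
  refine Runs.seq 2 (300 * (S * (K + 1)) - 7) (by omega) (Runs.setNat (by simp [NatExpr.cost]) ?_)
  set s₁ := Store.setNat _ 5 _ with hs₁
  have hr1 : s₁.realVar 1 = δ := by
    simp [hs₁, Store.setNat, Store.setReal, RealExpr.eval, NatExpr.eval, input, hδdef]
  have hH₁ : Holding b B s₁.realVar 0 s₁ := by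
    refine ⟨?_, ?_, ?_, ?_, ?_, fun j => Nat.zero_le _, fun _ _ _ => rfl⟩
    · simp [hs₁, Store.setNat, Store.setReal, input]
    · simp [hs₁, Store.setNat, Store.setReal, input]
    · funext j
      simp [hs₁, Store.setNat, Store.setReal, input, Store.vec]
    · funext j
      simp [hs₁, Store.setNat, Store.setReal, input, Store.vec]
    · simp [hs₁, Store.setNat, Store.setReal, input, NatExpr.eval]
  refine Runs.seq (91 * S + 8) (107 * (S * K) + 40 * K + 60 * n + 40) (by omega)
    ((freeSweep_runs (hr1 ▸ hδ.le) hH₁).mono le_rfl ?_)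
  rintro s₂ ⟨x, hH₂, hI⟩
  rw [hr1] at hI
  have hxB : ((∑ j, x j : ℕ) : ℝ) ≤ δ * B := by
    have := hI.small
    rw [mul_comm (n : ℝ)] at this
    exact le_of_mul_le_mul_right this hnr
  refine Runs.seq (60 * n + 20) (107 * (S * K) + 40 * K + 20) (by omega)
    ((maxMarginal_runs (hH₂.of_natEq rfl rfl rfl rfl rfl fun _ _ _ => rfl)).mono le_rfl ?_)
  rintro s₃ ⟨hH₃, hr1', hD⟩
  rw [hH₂.real 1 (by simp) (by simp), hr1] at hr1'
  -- With `N` the norm of the initial vector the exponent vanishes, and the gap bound reduces to f x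
  -- ≥ 0.
  have hJ : GreedyInv f b B (∑ j, x j) δ z (s₃.realVar 3) 0 x := by
    refine ⟨le_rfl, by simpa using h0 x, fun _ j hj => ?_,
      fun _ j hj => absurd hj (Nat.not_lt_zero _)⟩
    refine (hD.le j j.2 hj).trans ?_
    rw [le_div_iff₀ (by linarith)]
    nlinarith [hD.nonneg]
  refine Runs.seq 3 ((107 * S + 40) * K + 10) (by omega)
    (Runs.setReal (by simp [RealExpr.cost, NatExpr.cost]) ?_)
  refine (thresholdLoop_runs (K := K) (x := x) hf hm h0 hδ.le (by linarith) hD.nonneg hK hz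
    ?_ ?_ ?_ ?_ hJ).mono le_rfl ?_
  · simp [Store.setReal, hr1']
  · simp [Store.setReal, RealExpr.eval, NatExpr.eval]
  · simp [Store.setReal]
  · refine hH₃.of_natEq ?_ ?_ ?_ ?_ ?_ (fun _ _ _ => rfl) <;> simp [Store.setReal, vec_eq]
  rintro s₄ ⟨x', θ, hθ, hθD, hH₄, hJ₄⟩
  rw [show output n s₄ = x' from hH₄.current]
  have hx'B : ∑ j, x' j ≤ B := by have := hH₄.left; omega
  refine ⟨⟨hH₄.le, hx'B⟩, ?_⟩
  have hfin := hJ₄.final hf hm h0 hδ.le hδ1 hθ hz hx'B hxB ?_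
  · rwa [show 4 * δ = ε by rw [hδdef]; ring] at hfin
  -- Of the two factors δ in the last threshold, one pays for δBD ≤ n f z and the other is the
  -- accuracy.
  have hBD := mul_maxMarginal_le hf h0 (by linarith) hH₃.le hI hxB hD hzmax
  calc (B : ℝ) * θ ≤ B * (s₃.realVar 3 * (δ * δ / n)) := by gcongr
    _ = δ / n * (δ * (B * s₃.realVar 3)) := by ring
    _ ≤ δ / n * (n * f z) := by gcongr
    _ = δ * f z := by field_simp

end Specs

end OracleRam

/-! ### The running time in terms of `sizeParam`. -/

open OracleRam in
theorem bitSize_le_sizeParam {n : ℕ} {b : Fin n → ℕ} (hb : ∀ i, 1 ≤ b i) {ε : ℝ} (hε : 0 < ε)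
    (hε1 : ε ≤ 1) : (bitSize b : ℝ) ≤ 2 * sizeParam b ε := by
  have h1 : ∀ i, ((Nat.size (b i) + 1 : ℕ) : ℝ) ≤ 2 + 2 * Real.log (b i) := by
    intro i
    have hpos : 0 < Nat.size (b i) := Nat.size_pos.2 (hb i)
    obtain ⟨k, hk⟩ : ∃ k, Nat.size (b i) = k + 1 := ⟨Nat.size (b i) - 1, by omega⟩
    have h2 : 2 ^ k ≤ b i := Nat.lt_size.1 (by omega)
    have h3 : (k : ℝ) * Real.log 2 ≤ Real.log (b i) := by
      rw [← Real.log_pow]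
      exact Real.log_le_log (by positivity) (by exact_mod_cast h2)
    -- As 2 log 2 > 1, the bit count k is at most 2 log (b i).
    have := Real.log_two_gt_d9
    have hk0 : (0 : ℝ) ≤ k := Nat.cast_nonneg k
    rw [hk]
    push_cast
    nlinarith
  have h2 : (n : ℝ) ≤ n / ε := by
    rw [le_div_iff₀ hε]
    nlinarith [Nat.cast_nonneg (α := ℝ) n]
  calc (bitSize b : ℝ) = ∑ i, ((Nat.size (b i) + 1 : ℕ) : ℝ) := by simp [bitSize]
    _ ≤ ∑ i, (2 + 2 * Real.log (b i)) := Finset.sum_le_sum fun i _ => h1 i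
    _ = 2 * (n + ∑ i, Real.log (b i)) := by
      rw [Finset.sum_add_distrib, ← Finset.mul_sum]; simp; ring
    _ ≤ 2 * sizeParam b ε := by unfold sizeParam; gcongr

/-- Since 2 ≤ n/ε² ≤ m/ε, the factor 16 adds 4 log 2 ≤ 4 log(m/ε). The lower bound lets constants be
absorbed later. -/
theorem log_div_sq_le {n : ℕ} (hn : 1 ≤ n) {b : Fin n → ℕ} {ε : ℝ}
    (hε : 0 < ε) (hε2 : ε ≤ 2 / 3) :
    Real.log (n / (ε / 4 * (ε / 4))) ≤ 5 * Real.log (sizeParam b ε / ε) ∧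
      2 / 3 ≤ Real.log (sizeParam b ε / ε) := by
  have hnr : (1 : ℝ) ≤ n := by exact_mod_cast hn
  have hsum : 0 ≤ ∑ i, Real.log (b i) :=
    Finset.sum_nonneg fun i _ => Real.log_natCast_nonneg _
  have h1 : n / (ε * ε) ≤ sizeParam b ε / ε := by
    rw [← div_div]
    unfold sizeParam
    gcongr
    linarith
  have h2 : 2 ≤ n / (ε * ε) := by
    rw [le_div_iff₀ (by positivity)]
    nlinarith
  have h3 := Real.log_le_log (by positivity) h1
  have h4 := Real.log_le_log (by norm_num) h2
  have h5 := Real.log_two_gt_d9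
  have h6 : Real.log (n / (ε / 4 * (ε / 4))) = 4 * Real.log 2 + Real.log (n / (ε * ε)) := by
    rw [show n / (ε / 4 * (ε / 4)) = 2 ^ 4 * (n / (ε * ε)) by field_simp; norm_num,
      Real.log_mul (by norm_num) (by positivity), Real.log_pow]
    norm_num
  exact ⟨by linarith, by linarith⟩

theorem exists_pow_le {n : ℕ} (hn : 1 ≤ n) {b : Fin n → ℕ} {ε : ℝ} (hε : 0 < ε)
    (hε2 : ε ≤ 2 / 3) : ∃ K : ℕ, (1 - ε / 4) ^ K ≤ ε / 4 * (ε / 4) / n ∧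
      (K : ℝ) + 1 ≤ 23 * Real.log (sizeParam b ε / ε) / ε := by
  obtain ⟨h1, h2⟩ := log_div_sq_le hn hε hε2
  set l := Real.log (sizeParam b ε / ε)
  have hnr : (0 : ℝ) < n := by exact_mod_cast hn
  set a := Real.log (n / (ε / 4 * (ε / 4))) with ha
  refine ⟨⌈a / (ε / 4)⌉₊, ?_, ?_⟩
  · have hle : a / (ε / 4) ≤ ⌈a / (ε / 4)⌉₊ := Nat.le_ceil _
    rw [div_le_iff₀ (by positivity)] at hle
    calc (1 - ε / 4) ^ ⌈a / (ε / 4)⌉₊ ≤ Real.exp (-(ε / 4)) ^ ⌈a / (ε / 4)⌉₊ := by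
          refine pow_le_pow_left₀ (by linarith) ?_ _
          have := Real.add_one_le_exp (-(ε / 4))
          linarith
      _ = Real.exp (-(⌈a / (ε / 4)⌉₊ * (ε / 4))) := by rw [← Real.exp_nat_mul]; congr 1; ring
      _ ≤ Real.exp (-a) := Real.exp_le_exp.2 (by linarith)
      _ = ε / 4 * (ε / 4) / n := by
        rw [ha, Real.exp_neg, Real.exp_log (by positivity), inv_div]
  · have hpos : 0 ≤ a / (ε / 4) := by
      refine div_nonneg (Real.log_nonneg ?_) (by positivity)
      have : (1 : ℝ) ≤ n := by exact_mod_cast hn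
      rw [le_div_iff₀ (by positivity)]
      nlinarith
    have h3 := Nat.ceil_lt_add_one hpos
    have h4 : a / (ε / 4) ≤ 20 * l / ε := by
      rw [div_le_div_iff₀ (by positivity) hε]
      nlinarith
    -- Rounding up and the extra 1 cost at most 2, absorbed here.
    have h5 : 2 ≤ 3 * l / ε := by
      rw [le_div_iff₀ hε]
      linarith
    have h6 : 23 * l / ε = 20 * l / ε + 3 * l / ε := by ring
    linarith

theorem mainTheorem6 :
    ∃ (P : OracleRam.Program) (C : ℝ),
      ∀ (n : ℕ) (b : Fin n → ℕ) (B : ℕ) (ε : ℝ) (f : (Fin n → ℕ) → ℝ),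
        1 ≤ n → (∀ i, 1 ≤ b i) → 0 < ε → ε < 1 - 1 / Real.exp 1 →
        (∀ x, 0 ≤ f x) → Monotone f → DRSubmodular f →
        ∃ (t : ℕ) (s : OracleRam.Store),
          OracleRam.Exec f P (OracleRam.input b B ε) t s ∧
          (t : ℝ) ≤ C * (sizeParam b ε * Real.log (sizeParam b ε / ε) / ε) ∧
          OracleRam.output n s ∈ budgetFeasible b B ∧
          ∀ z ∈ budgetFeasible b B,
            (1 - 1 / Real.exp 1 - ε) * f z ≤ f (OracleRam.output n s) := by
  -- The constant is 300 · 2 · 23.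
  refine ⟨OracleRam.thresholdGreedy, 13800, fun n b B ε f hn hb hε hε1 h0 hm hf => ?_⟩
  have hε2 : ε ≤ 2 / 3 := by
    have h3 : (1 : ℝ) / 3 ≤ 1 / Real.exp 1 :=
      one_div_le_one_div_of_le (Real.exp_pos 1) (by linarith [Real.exp_one_lt_d9])
    linarith
  obtain ⟨z, hz, hzmax⟩ := OracleRam.exists_isMaxOn_budgetFeasible f b B
  obtain ⟨K, hK, hK'⟩ := exists_pow_le hn hε hε2
  obtain ⟨t, s, hex, ht, hout, hval⟩ :=
    OracleRam.thresholdGreedy_runs hf hm h0 hn hε (by linarith) hK hz hzmax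
  refine ⟨t, s, hex, ?_, hout, fun y hy => le_trans ?_ hval⟩
  · have hS := bitSize_le_sizeParam hb hε (by linarith)
    have hm0 : 0 ≤ 2 * sizeParam b ε := (Nat.cast_nonneg _).trans hS
    calc (t : ℝ) ≤ 300 * (OracleRam.bitSize b * (K + 1)) := by exact_mod_cast ht
      _ ≤ 300 * ((2 * sizeParam b ε) * (23 * Real.log (sizeParam b ε / ε) / ε)) := by gcongr
      _ = 13800 * (sizeParam b ε * Real.log (sizeParam b ε / ε) / ε) := by ring
  -- Passing from the maximum to any feasible `y` needs 1 - 1/e - ε ≥ 0.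
  · exact mul_le_mul_of_nonneg_left (hzmax y hy) (by linarith)
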